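/- **Corollary 5.6 (Concentration of the hopcount).** Let $Z$ be an almost surely positive random variable whose distribution function $G(x)=\mathbb P(Z\le x)$ is continuous on $\mathbb R$, and assume that there is some $\hat x>0$ such that $G$ is twice continuously differentiable on $[0,\hat x]$ (with one-sided derivatives at the endpoints) and has right derivative $\lambda:=G'(0+)>0$ at $0$. Let $(s_n)_{n\in\mathbb N}$ be a sequence of positive real numbers with $$s_n^{3}(\log n)^2\log\log n\to 0\qquad\text{and}\qquad s_n\log n\to\infty\qquad (n\to\infty).$$ For each $n$, let $K_n$ be the complete graph with vertex set $\{1,\dots,n\}$, and let its edges $e$ carry independent identically distributed weights $X_{e}=X_{e,n}$ with $X_{e,n}\overset{d}{=}Z^{s_n}$. For $n\ge 2$, the weight of a self-avoiding path between the vertices $1$ and $2$ in $K_n$ is the sum of the weights of its edges, the optimal path is the (almost surely unique) self-avoiding path between $1$ and $2$ of smallest weight, and the hopcount $H_n$ is its number of edges. If $k_n$ are natural numbers with $k_n=s_n\log n$ for all sufficiently large $n$, then $$\mathbb P(H_n=k_n)\to 1\qquad\text{as } n\to\infty.$$ -/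

import Mathlib

open MeasureTheory ProbabilityTheory Filter Topology

/-- The weight of a self-avoiding path: the sum of the weights of its edges. Only the values of `w`
at edges of `G` are ever used. -/
def pathWeight {V : Type*} {G : SimpleGraph V} (w : Sym2 V → ℝ) {u v : V} (p : G.Path u v) : ℝ :=
  ((p : G.Walk u v).edges.map w).sum

/-- A self-avoiding path from `u` to `v` that minimizes the weight among all such paths. -/
def IsOptimalPath {V : Type*} {G : SimpleGraph V} (w : Sym2 V → ℝ) {u v : V}
    (p : G.Path u v) : Prop :=
  ∀ q : G.Path u v, pathWeight w p ≤ pathWeight w q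

open Classical in
/-- The hopcount: the number of edges of the optimal path from `u` to `v` if there is a unique
optimal path, and the default value `0` otherwise. For `u ≠ v` a genuine hopcount is never `0`. -/
noncomputable def hopcount {V : Type*} (G : SimpleGraph V) (w : Sym2 V → ℝ) (u v : V) : ℕ :=
  if h : ∃! p : G.Path u v, IsOptimalPath w p then (h.choose : G.Walk u v).length else 0

/-- The hopcount between the first two vertices (here numbered `0` and `1`) of the complete graph
on `n` vertices; it is meaningful for `2 ≤ n`. -/
noncomputable def completeHopcount (n : ℕ) (w : Sym2 (Fin n) → ℝ) : ℕ :=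
  if h : 2 ≤ n then
    hopcount (⊤ : SimpleGraph (Fin n)) w ⟨0, by omega⟩ ⟨1, by omega⟩
  else 0

/-! Write `L = log n` and let `K = s L` be the integer target. Since `G` is nearly linear at 0, a
weight is at most `τ` with probability of order `τ^(1/s)`. Hence the expected number of paths with
`k` edges and weight at most `t` is roughly `n^(k-1) (t/k)^(k/s)`. At `t = K e^(1-K)`, with `x =
K/k`, its logarithm is `(k/s)(log x - (x - 1))`: zero at `k = K` and negative otherwise. Integrality
of `K` and `k` makes the gap at least `1/(12 K²)`. The growth condition on `s` ensures that it beats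
all logarithmic corrections and that `s K² = s³ L²` tends to 0.

The threshold used is `K τ` with `τ = exp(1 - K + η)` and `η = 3 s log L`. A union bound with
negative moments (`measureReal_exists_light_path_le`, `expected_light_paths_le`) excludes light
paths of length other than `K`. A second moment argument for paths of length `K` with every edge at
most `τ`, restricted to layered paths so that overlaps obey a two-state recursion, gives a light
path (`sum_overlapWeight_le`, `measureReal_no_open_path_le`). Ties have probability zero, so the
optimal path has length `K`. -/

/-! ### Deterministic facts about paths and the hopcount. -/

section Paths

open SimpleGraph

variable {V : Type*} {G : SimpleGraph V}

/-- A self-avoiding path is determined by its endpoints together with its set of edges. -/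
theorem SimpleGraph.Walk.IsPath.eq_of_edges_subset {u v : V} {p q : G.Walk u v}
    (hp : p.IsPath) (hq : q.IsPath) (h : p.edges ⊆ q.edges) : p = q := by
  induction p with
  | nil => exact (Walk.eq_nil_iff_nil.2 (Walk.isPath_iff_nil.1 hq)).symm
  | @cons u a v hua p ih =>
    cases q with
    | nil => exact absurd hp (by simp)
    | @cons _ b _ hub q =>
      rw [Walk.cons_isPath_iff] at hp hq
      -- The only edge of `q` at `u` is its first, so both paths begin with the same edge.
      have h1 : s(u, a) ∈ s(u, b) :: q.edges := h (by simp)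
      have hab : a = b := by
        rcases List.mem_cons.1 h1 with h2 | h2
        · rcases Sym2.eq_iff.1 h2 with h3 | h3
          · exact h3.2
          · exact absurd h3.1 hub.ne
        · exact absurd (q.fst_mem_support_of_mem_edges h2) hq.2
      subst hab
      congr 1
      refine ih hp.1 hq.1 fun e he => ?_
      rcases List.mem_cons.1 (h (List.mem_cons_of_mem _ he)) with h2 | h2
      · subst h2
        exact absurd (p.fst_mem_support_of_mem_edges he) hp.2
      · exact h2

/-- If some path of length `K` is lighter than all paths of other lengths, and there are no ties,
then the hopcount is `K`. -/
theorem hopcount_eq_of_forall {u v : V} [Finite (G.Path u v)] (w : Sym2 V → ℝ) (K : ℕ) (t : ℝ)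
    (hex : ∃ q : G.Path u v, pathWeight w q ≤ t)
    (hlen : ∀ q : G.Path u v, (q : G.Walk u v).length ≠ K → t < pathWeight w q)
    (htie : ∀ p q : G.Path u v, p ≠ q → pathWeight w p ≠ pathWeight w q) :
    hopcount G w u v = K := by
  obtain ⟨q, hq⟩ := hex
  have : Nonempty (G.Path u v) := ⟨q⟩
  obtain ⟨p, hp⟩ := Finite.exists_min (fun p : G.Path u v => pathWeight w p)
  have huniq : ∃! p : G.Path u v, IsOptimalPath w p :=
    ⟨p, hp, fun p' hp' => by
      by_contra hne
      exact htie p' p hne (le_antisymm (hp' p) (hp p'))⟩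
  rw [hopcount, dif_pos huniq]
  by_contra hne
  exact absurd ((huniq.choose_spec.1 q).trans hq) (not_le.2 (hlen _ hne))

/-- The walk through a given sequence of vertices. -/
theorem SimpleGraph.exists_walk_of_seq (x : ℕ → V) (K : ℕ) (h : ∀ i < K, G.Adj (x i) (x (i + 1))) :
    ∃ p : G.Walk (x 0) (x K), p.support = (List.range (K + 1)).map x ∧
      p.edges = (List.range K).map fun i => s(x i, x (i + 1)) := by
  induction K with
  | zero => exact ⟨Walk.nil, by simp, by simp⟩
  | succ K ih =>
    obtain ⟨p, hp, hp'⟩ := ih fun i hi => h i (by omega)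
    refine ⟨p.concat (h K (by omega)), ?_, ?_⟩
    · rw [Walk.support_concat, hp, List.range_succ (n := K + 1)]
      simp
    · rw [Walk.edges_concat, hp', List.range_succ (n := K)]
      simp

/-- In a graph on `Fin n` there are at most `n ^ (k - 1)` walks of length `k` between two given
vertices. -/
theorem card_path_length_le {n : ℕ} {G : SimpleGraph (Fin n)} (u v : Fin n)
    [Fintype (G.Path u v)] (k : ℕ) :
    (Finset.univ.filter fun q : G.Path u v => (q : G.Walk u v).length = k).card ≤ n ^ (k - 1) := by
  have : Fintype.card (Fin (k - 1) → Fin n) = n ^ (k - 1) := by simp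
  rw [← this, ← Finset.card_univ]
  -- Both endpoints are fixed, so only the `k - 1` interior vertices are recorded.
  refine Finset.card_le_card_of_injOn (fun q i => (q : G.Walk u v).getVert (i + 1))
    (fun _ _ => Finset.mem_coe.2 (Finset.mem_univ _)) ?_
  intro p hp q hq hpq
  simp only [Finset.coe_filter, Finset.mem_univ, true_and, Set.mem_ofPred_eq] at hp hq
  refine Subtype.ext (Walk.ext_getVert_le_length (hp.trans hq.symm) fun j hj => ?_)
  rcases Nat.eq_zero_or_pos j with rfl | hj0
  · simp
  rcases eq_or_lt_of_le hj with rfl | hj1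
  · rw [Walk.getVert_length, hp, ← hq, Walk.getVert_length]
  · have := congrFun hpq ⟨j - 1, by omega⟩
    simpa [Nat.sub_add_cancel hj0] using this

open Classical in
/-- The path weight as a sum over the edges of the graph. -/
theorem pathWeight_eq_sum [Fintype G.edgeSet] (w : Sym2 V → ℝ) {u v : V} (p : G.Path u v) :
    pathWeight w p =
      ∑ e ∈ Finset.univ.filter (fun e : G.edgeSet => (e : Sym2 V) ∈ (p : G.Walk u v).edges), w e := by
  rw [pathWeight, ← List.sum_toFinset _ p.2.isTrail.edges_nodup]
  symm
  refine Finset.sum_bij (fun e _ => (e : Sym2 V)) (by simp) (fun a _ b _ h => Subtype.ext h) ?_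
    (fun _ _ => rfl)
  intro b hb
  rw [List.mem_toFinset] at hb
  exact ⟨⟨b, (p : G.Walk u v).edges_subset_edgeSet hb⟩, by simpa using hb, rfl⟩

open Classical in
theorem card_filter_mem_edges [Fintype G.edgeSet] {u v : V} (p : G.Path u v) :
    (Finset.univ.filter
      (fun e : G.edgeSet => (e : Sym2 V) ∈ (p : G.Walk u v).edges)).card =
      (p : G.Walk u v).length := by
  rw [← Walk.length_edges, ← List.toFinset_card_of_nodup p.2.isTrail.edges_nodup]
  refine Finset.card_bij (fun e _ => (e : Sym2 V)) (by simp) (fun a _ b _ h => Subtype.ext h) ?_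
  intro b hb
  rw [List.mem_toFinset] at hb
  exact ⟨⟨b, (p : G.Walk u v).edges_subset_edgeSet hb⟩, by simpa using hb, rfl⟩

end Paths

/-! ### Independence, negative moments and the second moment method. -/

section Probability

open scoped ENNReal

variable {Ω : Type*} [MeasurableSpace Ω] {P : Measure Ω}

/-- The probability that all variables in a finite set are at most `τ`. -/
theorem measureReal_forall_le {ι : Type*} {X : ι → Ω → ℝ} (hX : iIndepFun X P) {τ p : ℝ}
    (hp : ∀ i, P.real {ω | X i ω ≤ τ} = p) (S : Finset ι) :
    P.real {ω | ∀ i ∈ S, X i ω ≤ τ} = p ^ S.card := by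
  have h := hX.measure_inter_preimage_eq_mul S (sets := fun _ => Set.Iic τ)
    fun _ _ => measurableSet_Iic
  have hset : {ω | ∀ i ∈ S, X i ω ≤ τ} = ⋂ i ∈ S, X i ⁻¹' Set.Iic τ := by
    ext ω
    simp
  rw [hset, measureReal_def, h, ENNReal.toReal_prod, ← Finset.prod_const]
  exact Finset.prod_congr rfl fun i _ => hp i

/-- A linear combination of independent random variables almost surely does not vanish, if one of
the variables has no atoms and a nonzero coefficient. -/
theorem measure_sum_mul_eq_zero [IsProbabilityMeasure P] {ι : Type*} [Fintype ι] [DecidableEq ι] {X : ι → Ω → ℝ}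
    (hX : iIndepFun X P) (hm : ∀ i, Measurable (X i)) (c : ι → ℝ) (e : ι) (hc : c e ≠ 0)
    (hatom : ∀ y, P (X e ⁻¹' {y}) = 0) : P {ω | ∑ i, c i * X i ω = 0} = 0 := by
  have hY : iIndepFun (fun i ω => c i * X i ω) P :=
    hX.comp (fun i x => c i * x) fun i => by fun_prop
  have hYm : ∀ i, Measurable (fun ω => c i * X i ω) := fun i => (hm i).const_mul _
  have hind := hY.indepFun_finsetSum_of_notMem hYm (Finset.notMem_erase e Finset.univ)
  set D : Ω → ℝ := ∑ j ∈ Finset.univ.erase e, fun ω => c j * X j ω with hD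
  have hDm : Measurable D := by
    rw [hD]
    fun_prop
  have hset : {ω | ∑ i, c i * X i ω = 0} =
      (fun ω => (D ω, c e * X e ω)) ⁻¹' {x : ℝ × ℝ | x.1 + x.2 = 0} := by
    ext ω
    simp only [Set.mem_ofPred_eq, Set.mem_preimage, hD, Finset.sum_apply]
    rw [Finset.sum_erase_add _ _ (Finset.mem_univ e)]
  have hmeas : MeasurableSet {x : ℝ × ℝ | x.1 + x.2 = 0} :=
    measurableSet_eq_fun (by fun_prop) (by fun_prop)
  rw [hset, ← Measure.map_apply (hDm.prodMk (hYm e)) hmeas,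
    (indepFun_iff_map_prod_eq_prod_map_map hDm.aemeasurable (hYm e).aemeasurable).1 hind,
    Measure.measure_prod_null hmeas]
  -- By Fubini: once the other summands are fixed, `X e` is confined to a single value.
  refine Eventually.of_forall fun d => ?_
  have hpre : Prod.mk d ⁻¹' {x : ℝ × ℝ | x.1 + x.2 = 0} = {-d} := by
    ext y
    simp only [Set.mem_preimage, Set.mem_ofPred_eq, Set.mem_singleton_iff]
    constructor <;> intro h <;> linarith
  change (P.map fun ω => c e * X e ω) (Prod.mk d ⁻¹' _) = 0
  rw [hpre, Measure.map_apply (hYm e) (measurableSet_singleton _)]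
  refine measure_mono_null (fun ω hω => ?_) (hatom (-d / c e))
  simp only [Set.mem_preimage, Set.mem_singleton_iff] at hω ⊢
  rw [← hω, mul_div_cancel_left₀ _ hc]

/-- A lower tail bound for a sum of independent positive random variables in terms of a negative
moment, from the inequality of arithmetic and geometric means. -/
theorem measure_sum_le_le {ι : Type*} {X : ι → Ω → ℝ}
    (hX : iIndepFun X P) (hm : ∀ i, Measurable (X i)) (hpos : ∀ i, ∀ᵐ ω ∂P, 0 < X i ω)
    {b : ℝ} (hb : 0 < b) {M : ℝ≥0∞} (hM : ∀ i, ∫⁻ ω, ENNReal.ofReal (X i ω ^ (-b)) ∂P ≤ M)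
    (S : Finset ι) (hS : S.Nonempty) {t : ℝ} (ht : 0 < t) :
    P {ω | ∑ i ∈ S, X i ω ≤ t} ≤ ENNReal.ofReal ((t / S.card) ^ (S.card * b)) * M ^ S.card := by
  set k : ℕ := S.card with hk
  have hk0 : (0 : ℝ) < k := by exact_mod_cast hS.card_pos
  have htk : 0 < t / k := by positivity
  set ε : ℝ≥0∞ := ENNReal.ofReal ((t / k) ^ (-(k * b))) with hε
  have hind : iIndepFun (fun i ω => ENNReal.ofReal (X i ω ^ (-b))) P :=
    hX.comp (fun i x => ENNReal.ofReal (x ^ (-b))) fun i => by fun_prop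
  have hfm : ∀ i, Measurable (fun ω => ENNReal.ofReal (X i ω ^ (-b))) := fun i => by
    have := hm i
    fun_prop
  -- AM-GM turns a small sum into a small product, hence a large product of negative powers.
  -- Markov's inequality then applies, and independence factors the mean.
  have h1 : P {ω | ∑ i ∈ S, X i ω ≤ t} ≤
      P {ω | ε ≤ ∏ i ∈ S, ENNReal.ofReal (X i ω ^ (-b))} := by
    refine measure_mono_ae ?_
    have hall : ∀ᵐ ω ∂P, ∀ i ∈ S, 0 < X i ω :=
      (ae_ball_iff S.countable_toSet).2 fun i _ => hpos i
    filter_upwards [hall] with ω hω hsum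
    change ε ≤ _
    replace hsum : ∑ i ∈ S, X i ω ≤ t := hsum
    have hamgm := Real.geom_mean_le_arith_mean_weighted S (fun _ => (k : ℝ)⁻¹) (fun i => X i ω)
      (fun _ _ => by positivity) (by simp [← hk, hk0.ne']) (fun i hi => (hω i hi).le)
    rw [← Finset.mul_sum] at hamgm
    have hprod : 0 < ∏ i ∈ S, X i ω ^ (k : ℝ)⁻¹ :=
      Finset.prod_pos fun i hi => Real.rpow_pos_of_pos (hω i hi) _
    have hle : ∏ i ∈ S, X i ω ^ (k : ℝ)⁻¹ ≤ t / k := by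
      refine hamgm.trans ?_
      rw [div_eq_inv_mul]
      gcongr
    rw [← ENNReal.ofReal_prod_of_nonneg fun i hi => Real.rpow_nonneg (hω i hi).le _]
    refine ENNReal.ofReal_le_ofReal ?_
    refine (Real.rpow_le_rpow_of_nonpos hprod hle (by nlinarith)).trans_eq ?_
    rw [← Real.finsetProd_rpow _ _ fun i hi => Real.rpow_nonneg (hω i hi).le _]
    refine Finset.prod_congr rfl fun i hi => ?_
    rw [← Real.rpow_mul (hω i hi).le]
    congr 1
    field_simp
  have h2 : ε * P {ω | ε ≤ ∏ i ∈ S, ENNReal.ofReal (X i ω ^ (-b))} ≤ M ^ k := by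
    refine (mul_meas_ge_le_lintegral (Finset.measurable_prod _ fun i _ => hfm i) ε).trans ?_
    rw [lintegral_prod_eq_prod_lintegral_of_indepFun S _ hind hfm, hk, ← Finset.prod_const]
    exact Finset.prod_le_prod' fun i _ => hM i
  have hmul : ENNReal.ofReal ((t / k) ^ (k * b)) * ε = 1 := by
    rw [hε, ← ENNReal.ofReal_mul (by positivity), ← Real.rpow_add htk]
    simp
  calc P {ω | ∑ i ∈ S, X i ω ≤ t}
      ≤ ENNReal.ofReal ((t / k) ^ (k * b)) * (ε *
          P {ω | ε ≤ ∏ i ∈ S, ENNReal.ofReal (X i ω ^ (-b))}) := by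
        rw [← mul_assoc, hmul, one_mul]; exact h1
    _ ≤ _ := by gcongr

variable [IsProbabilityMeasure P]

/-- A negative moment bound for a positive random variable whose distribution function grows at
most linearly at zero. -/
theorem lintegral_rpow_neg_le {Z : Ω → ℝ} (hZ : AEMeasurable Z P) (hpos : ∀ᵐ ω ∂P, 0 < Z ω)
    {C : ℝ} (hC : 0 ≤ C) (hcdf : ∀ x, 0 ≤ x → P.real {ω | Z ω ≤ x} ≤ C * x)
    {a : ℝ} (ha0 : 0 < a) (ha1 : a < 1) :
    ∫⁻ ω, ENNReal.ofReal (Z ω ^ (-a)) ∂P ≤ ENNReal.ofReal (1 + C / (1 - a)) := by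
  have hnn : ∀ᵐ ω ∂P, 0 ≤ Z ω ^ (-a) := hpos.mono fun ω h => Real.rpow_nonneg h.le _
  rw [lintegral_eq_lintegral_meas_lt P hnn (hZ.pow_const _)]
  -- In the layer-cake integral the tail is at most 1 below level 1, and at most `C y^(-1/a)` above
  -- it, integrable since `1/a > 1`.
  have hsplit : Set.Ioi (0 : ℝ) = Set.Ioc 0 1 ∪ Set.Ioi 1 := (Set.Ioc_union_Ioi_eq_Ioi
    zero_le_one).symm
  have hinv : -a⁻¹ < -1 := by
    have := (one_lt_inv₀ ha0).2 ha1
    linarith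
  have h1 : ∫⁻ y in Set.Ioc (0 : ℝ) 1, P {ω | y < Z ω ^ (-a)} ≤ 1 := by
    calc ∫⁻ y in Set.Ioc (0 : ℝ) 1, P {ω | y < Z ω ^ (-a)}
        ≤ ∫⁻ _ in Set.Ioc (0 : ℝ) 1, 1 := lintegral_mono fun y => prob_le_one
      _ = 1 := by simp
  have h2 : ∫⁻ y in Set.Ioi (1 : ℝ), P {ω | y < Z ω ^ (-a)} ≤
      ∫⁻ y in Set.Ioi (1 : ℝ), ENNReal.ofReal (C * y ^ (-a⁻¹)) := by
    refine setLIntegral_mono' measurableSet_Ioi fun y hy => ?_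
    have hy0 : (0 : ℝ) < y := zero_lt_one.trans hy
    calc P {ω | y < Z ω ^ (-a)} ≤ P {ω | Z ω ≤ y ^ (-a⁻¹)} := by
          refine measure_mono_ae ?_
          filter_upwards [hpos] with ω hω h
          replace h : y < Z ω ^ (-a) := h
          change Z ω ≤ y ^ (-a⁻¹)
          have := Real.rpow_le_rpow_of_nonpos hy0 h.le (z := -a⁻¹) (by
            have := inv_pos.2 ha0
            linarith)
          rwa [← Real.rpow_mul hω.le, neg_mul_neg, mul_inv_cancel₀ ha0.ne', Real.rpow_one] at this
      _ ≤ ENNReal.ofReal (C * y ^ (-a⁻¹)) := by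
          rw [← ofReal_measureReal]
          exact ENNReal.ofReal_le_ofReal (hcdf _ (by positivity))
  have h3 : ∫⁻ y in Set.Ioi (1 : ℝ), ENNReal.ofReal (C * y ^ (-a⁻¹)) ≤
      ENNReal.ofReal (C / (1 - a)) := by
    rw [← ofReal_integral_eq_lintegral_ofReal
      ((integrableOn_Ioi_rpow_of_lt hinv zero_lt_one).const_mul C)]
    · refine ENNReal.ofReal_le_ofReal ?_
      rw [integral_const_mul, integral_Ioi_rpow_of_lt hinv zero_lt_one, Real.one_rpow,
        div_eq_mul_inv C]
      refine mul_le_mul_of_nonneg_left ?_ hC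
      have h5 : (-1 : ℝ) / (-a⁻¹ + 1) = 1 / (a⁻¹ - 1) := by
        rw [← neg_div_neg_eq]
        congr 1 <;> ring
      rw [h5, ← one_div (1 - a)]
      refine one_div_le_one_div_of_le (by linarith) ?_
      have : (1 : ℝ) - a ≤ a⁻¹ * (1 - a) :=
        le_mul_of_one_le_left (by linarith) (by linarith)
      have h4 : a⁻¹ * (1 - a) = -1 + a⁻¹ := by field_simp; ring
      linarith
    · refine (ae_restrict_mem measurableSet_Ioi).mono fun y hy => ?_
      have hy0 : (0 : ℝ) < y := zero_lt_one.trans hy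
      exact mul_nonneg hC (Real.rpow_nonneg hy0.le _)
  rw [hsplit, lintegral_union measurableSet_Ioi (Set.Ioc_disjoint_Ioi le_rfl),
    ENNReal.ofReal_add zero_le_one (div_nonneg hC (by linarith)), ENNReal.ofReal_one]
  exact add_le_add h1 (h2.trans h3)

/-- The second moment method for a family of events of equal probability. -/
theorem measureReal_iInter_compl_le {F : Type*} [Fintype F] [Nonempty F] {A : F → Set Ω}
    (hA : ∀ f, MeasurableSet (A f)) {π ε : ℝ} (hπ : 0 < π) (h1 : ∀ f, P.real (A f) = π)
    (h2 : ∀ f, ∑ g, P.real (A f ∩ A g) ≤ (1 + ε) * (Fintype.card F * π ^ 2)) :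
    P.real (⋂ f, (A f)ᶜ) ≤ ε := by
  set c : ℝ := (Fintype.card F : ℝ) with hc
  have hc0 : 0 < c := by
    rw [hc]
    exact Nat.cast_pos.2 Fintype.card_pos
  set μ : ℝ := c * π with hμ
  have hμ0 : 0 < μ := mul_pos hc0 hπ
  let I : F → Ω → ℝ := fun f => (A f).indicator fun _ => 1
  have hI : ∀ f, Integrable (I f) P := fun f => (integrable_const 1).indicator (hA f)
  have hIIeq : ∀ f g, (fun ω => I f ω * I g ω) = (A f ∩ A g).indicator fun _ => 1 := fun f g => by
    classical
    ext ω
    simp only [I, Set.indicator_apply, Set.mem_inter_iff]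
    split_ifs <;> simp_all
  have hII : ∀ f g, Integrable (fun ω => I f ω * I g ω) P := fun f g => by
    rw [hIIeq]
    exact (integrable_const 1).indicator ((hA f).inter (hA g))
  have hIIint : ∀ f g, ∫ ω, I f ω * I g ω ∂P = P.real (A f ∩ A g) := fun f g => by
    rw [hIIeq]
    exact integral_indicator_one ((hA f).inter (hA g))
  have hIint : ∀ f, ∫ ω, I f ω ∂P = π := fun f => by
    rw [← h1 f]
    exact integral_indicator_one (hA f)
  have hexp : ∀ ω, (∑ f, I f ω - μ) ^ 2 =
      (∑ f, ∑ g, I f ω * I g ω) - 2 * μ * (∑ f, I f ω) + μ ^ 2 := fun ω => by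
    rw [← Finset.sum_mul_sum]
    ring
  have hint1 : Integrable (fun ω => ∑ f, ∑ g, I f ω * I g ω) P :=
    integrable_finsetSum _ fun f _ => integrable_finsetSum _ fun g _ => hII f g
  have hint2 : Integrable (fun ω => 2 * μ * ∑ f, I f ω) P :=
    (integrable_finsetSum _ fun f _ => hI f).const_mul _
  have hint3 : Integrable (fun ω => (∑ f, ∑ g, I f ω * I g ω) - 2 * μ * ∑ f, I f ω) P :=
    hint1.sub hint2
  have hint : Integrable (fun ω => (∑ f, I f ω - μ) ^ 2) P := by
    simp_rw [hexp]
    exact hint3.add (integrable_const _)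
  have hval : ∫ ω, (∑ f, I f ω - μ) ^ 2 ∂P ≤ ε * μ ^ 2 := by
    simp_rw [hexp]
    rw [integral_add hint3 (integrable_const _), integral_sub hint1 hint2,
      integral_finsetSum _ fun f _ => integrable_finsetSum _ fun g _ => hII f g,
      integral_const_mul, integral_finsetSum _ fun f _ => hI f]
    simp_rw [integral_finsetSum _ fun g _ => hII _ g, hIIint, hIint]
    have : ∑ f, ∑ g, P.real (A f ∩ A g) ≤ ∑ _f : F, (1 + ε) * (c * π ^ 2) :=
      Finset.sum_le_sum fun f _ => h2 f
    simp only [Finset.sum_const, Finset.card_univ, nsmul_eq_mul, ← hc] at this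
    simp only [Finset.sum_const, Finset.card_univ, nsmul_eq_mul, ← hc, integral_const,
      probReal_univ, smul_eq_mul, one_mul]
    rw [hμ]
    nlinarith
  have hmarkov := mul_meas_ge_le_integral_of_nonneg
    (Eventually.of_forall fun ω => sq_nonneg (∑ f, I f ω - μ)) hint (μ ^ 2)
  -- If no event occurs, the count is 0 and deviates from its mean by exactly `μ`.
  have hsub : P.real (⋂ f, (A f)ᶜ) ≤ P.real {ω | μ ^ 2 ≤ (∑ f, I f ω - μ) ^ 2} := by
    refine measureReal_mono fun ω hω => ?_
    have h0 : ∀ f, I f ω = 0 := fun f =>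
      Set.indicator_of_notMem (Set.mem_iInter.1 hω f) _
    simp [h0]
  have hμ2 : 0 < μ ^ 2 := by positivity
  have := hmarkov.trans hval
  have h3 := mul_le_mul_of_nonneg_left hsub hμ2.le
  exact le_of_mul_le_mul_left (by linarith) hμ2

end Probability

/-! ### Second moment of the number of open layered paths. -/

section Layered

/-- Whether the sequences of vertices with inner parts `f` and `g` agree at position `i`, given
that `a` describes the agreement at position `0` and that the last vertices agree. -/
def agreeAt {m q : ℕ} (a : Prop) (f g : Fin q → Fin m) (i : ℕ) : Prop :=
  match i with
  | 0 => a
  -- Vacuous for `i ≥ q`, so the common last vertex, at position `q + 1`, counts as agreement.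
  | i + 1 => ∀ h : i < q, f ⟨i, h⟩ = g ⟨i, h⟩

open Classical in
/-- The conditional probability that a layered path is open given that another one is open. -/
noncomputable def overlapWeight {m q : ℕ} (p : ℝ) (a : Prop) (f g : Fin q → Fin m) : ℝ :=
  ∏ i ∈ Finset.range (q + 1), if agreeAt a f g i ∧ agreeAt a f g (i + 1) then 1 else p

variable {m : ℕ} {p : ℝ}

open Classical in
theorem overlapWeight_zero (a : Prop) (f g : Fin 0 → Fin m) :
    overlapWeight p a f g = if a then 1 else p := by
  simp [overlapWeight, agreeAt]

open Classical in
-- Removing the first layer turns agreement there into the new initial state, so overlaps form a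
-- chain with two states.
theorem overlapWeight_succ {q : ℕ} (a : Prop) (f g : Fin (q + 1) → Fin m) :
    overlapWeight p a f g = (if a ∧ f 0 = g 0 then 1 else p) *
      overlapWeight p (f 0 = g 0) (Fin.tail f) (Fin.tail g) := by
  have hag : ∀ i, agreeAt a f g (i + 1) = agreeAt (f 0 = g 0) (Fin.tail f) (Fin.tail g) i := by
    rintro (_ | i)
    · simp [agreeAt]
    · simp [agreeAt, Fin.tail]
  rw [overlapWeight, Finset.prod_range_succ', mul_comm, overlapWeight]
  simp only [hag]
  congr 1
  exact if_congr Iff.rfl rfl rfl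

theorem overlapWeight_nonneg (hp : 0 ≤ p) {q : ℕ} (a : Prop) (f g : Fin q → Fin m) :
    0 ≤ overlapWeight p a f g :=
  Finset.prod_nonneg fun i _ => by split_ifs <;> linarith

open Classical in
-- Only `g 0 = f 0` leads to the agreeing state. The remaining choices cost `p` each and restart
-- from disagreement; for simplicity all `m` choices are charged `p * B`.
theorem sum_overlapWeight_succ_le (hp : 0 ≤ p) {q : ℕ} (a : Prop) (f : Fin (q + 1) → Fin m) {B : ℝ}
    (hB : ∑ g, overlapWeight p False (Fin.tail f) g ≤ B) :
    ∑ g, overlapWeight p a f g ≤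
      (if a then 1 else p) * ∑ g, overlapWeight p True (Fin.tail f) g + m * (p * B) := by
  have hB0 : 0 ≤ B := (Finset.sum_nonneg fun g _ => overlapWeight_nonneg hp _ _ g).trans hB
  have hsum : ∑ g, overlapWeight p a f g = ∑ x : Fin m, (if a ∧ f 0 = x then 1 else p) *
      ∑ g, overlapWeight p (f 0 = x) (Fin.tail f) g := by
    rw [← (Fin.consEquiv fun _ : Fin (q + 1) => Fin m).sum_comp, Fintype.sum_prod_type]
    refine Finset.sum_congr rfl fun x _ => ?_
    rw [Finset.mul_sum]
    refine Finset.sum_congr rfl fun g _ => ?_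
    rw [overlapWeight_succ]
    simp [Fin.consEquiv]
  have hterm : ∀ x : Fin m, (if a ∧ f 0 = x then 1 else p) *
      ∑ g, overlapWeight p (f 0 = x) (Fin.tail f) g ≤
      (if f 0 = x then (if a then 1 else p) * ∑ g, overlapWeight p True (Fin.tail f) g else 0) +
        p * B := fun x => by
    by_cases hx : f 0 = x
    · simp only [hx, and_true, if_true]
      exact le_add_of_nonneg_right (mul_nonneg hp hB0)
    · simp only [hx, and_false, if_false, zero_add]
      exact mul_le_mul_of_nonneg_left hB hp
  rw [hsum]
  refine (Finset.sum_le_sum fun x _ => hterm x).trans_eq ?_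
  rw [Finset.sum_add_distrib, Finset.sum_ite_eq]
  simp

/-- Divided by `m^q p^(q+1)`, the sums `T` (agreeing) and `F` (disagreeing) satisfy `T' ≤ r T + F`
and `F' ≤ T/m + F`. The term `r^q / p` is the contribution of `g = f`. The reserve `-2 r^(q+1)` in
the bound on `F` absorbs the `r^(q+1)` coming from `T/m`, because `2 r ≤ 1`. -/
theorem sum_overlapWeight_le_aux (hp : 0 < p) (hm : 0 < m) {r : ℝ}
    (hr : r = 1 / (m * p)) (q : ℕ) (hrq : 2 * r + 4 * (q / m) ≤ 1) (f : Fin q → Fin m) :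
    ∑ g, overlapWeight p True f g ≤ m ^ q * p ^ (q + 1) * (r ^ q / p + 4) ∧
    ∑ g, overlapWeight p False f g ≤
      m ^ q * p ^ (q + 1) * (1 + 2 * r + 4 * (q / m) - 2 * r ^ (q + 1)) := by
  have hm' : (0 : ℝ) < m := by exact_mod_cast hm
  have hr0 : 0 < r := by rw [hr]; positivity
  have hpr : m * p * r = 1 := by rw [hr]; field_simp
  induction q with
  | zero =>
    simp only [overlapWeight_zero]
    constructor
    · simp only [if_true, Finset.univ_unique, Finset.sum_const, Finset.card_singleton, one_smul,
        pow_zero, zero_add, pow_one, one_mul]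
      rw [mul_add, mul_div_cancel₀ _ hp.ne']
      linarith
    · simp
  | succ q ih =>
    have hq0 : (0 : ℝ) ≤ (q : ℝ) / m := by positivity
    have hsucc : ((q + 1 : ℕ) : ℝ) / m = q / m + 1 / m := by push_cast; ring
    have hm1 : (0 : ℝ) < 1 / m := by positivity
    rw [hsucc] at hrq ⊢
    obtain ⟨ihT, ihF⟩ := ih (by linarith) (Fin.tail f)
    have hrpow : 0 < r ^ (q + 1) := by positivity
    have hc : 0 < (m : ℝ) ^ q * p ^ (q + 1) := by positivity
    have hT := sum_overlapWeight_succ_le hp.le True f ihF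
    have hF := sum_overlapWeight_succ_le hp.le False f ihF
    simp only [if_true, if_false, one_mul] at hT hF
    have hone : (m : ℝ) ^ q * p ^ (q + 1) = m ^ (q + 1) * p ^ (q + 1 + 1) * r := by
      rw [pow_succ (m : ℝ), pow_succ p (q + 1)]
      linear_combination -(m : ℝ) ^ q * p ^ (q + 1) * hpr
    have hc' : 0 < (m : ℝ) ^ (q + 1) * p ^ (q + 1 + 1) := by positivity
    have hmul : (m : ℝ) * (p * (m ^ q * p ^ (q + 1) *
        (1 + 2 * r + 4 * (q / m) - 2 * r ^ (q + 1)))) = m ^ (q + 1) * p ^ (q + 1 + 1) *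
        (1 + 2 * r + 4 * (q / m) - 2 * r ^ (q + 1)) := by ring
    rw [hmul] at hT hF
    constructor
    · refine hT.trans ((add_le_add_left ihT _).trans ?_)
      rw [hone, mul_assoc _ r, ← mul_add]
      refine mul_le_mul_of_nonneg_left ?_ hc'.le
      have : r * (r ^ q / p + 4) = r ^ (q + 1) / p + 4 * r := by ring
      rw [this]
      linarith
    · refine hF.trans ((add_le_add_left (mul_le_mul_of_nonneg_left ihT hp.le) _).trans ?_)
      have hpm : p * (m ^ q * p ^ (q + 1) * (r ^ q / p + 4)) =
          m ^ (q + 1) * p ^ (q + 1 + 1) * (r ^ (q + 1) + 4 * (1 / m)) := by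
        have h1 : (1 : ℝ) / m = p * r := by
          rw [hr]; field_simp
        rw [hone, h1]
        field_simp
        ring
      rw [hpm, ← mul_add]
      refine mul_le_mul_of_nonneg_left ?_ hc'.le
      have : 2 * r ^ (q + 1 + 1) ≤ r ^ (q + 1) := by
        rw [pow_succ r (q + 1)]
        nlinarith
      linarith

/-- The key estimate for the second moment of the number of open layered paths. -/
theorem sum_overlapWeight_le (hp : 0 < p) (hm : 0 < m) {r : ℝ}
    (hr : r = 1 / (m * p)) (q : ℕ) (hq : 1 ≤ q) (hrq : 2 * r + 4 * (q / m) ≤ 1)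
    (f : Fin q → Fin m) :
    ∑ g, overlapWeight p True f g ≤
      m ^ q * p ^ (q + 1) * (1 + (r ^ q / p + 6 * r + 4 * (q / m))) := by
  obtain ⟨q, rfl⟩ : ∃ q', q = q' + 1 := ⟨q - 1, by omega⟩
  have hm' : (0 : ℝ) < m := by exact_mod_cast hm
  have hr0 : 0 < r := by rw [hr]; positivity
  have hpr : m * p * r = 1 := by rw [hr]; field_simp
  have hsucc : ((q + 1 : ℕ) : ℝ) / m = q / m + 1 / m := by push_cast; ring
  have hm1 : (0 : ℝ) < 1 / m := by positivity
  rw [hsucc] at hrq ⊢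
  -- One further step of the recursion shrinks the crude constant 4 to `4 r`, leaving the leading
  -- constant 1.
  obtain ⟨ihT, ihF⟩ := sum_overlapWeight_le_aux hp hm hr q (by linarith) (Fin.tail f)
  have hrpow : 0 < r ^ (q + 1) := by positivity
  have hT := sum_overlapWeight_succ_le hp.le True f ihF
  simp only [if_true, one_mul] at hT
  have hone : (m : ℝ) ^ q * p ^ (q + 1) = m ^ (q + 1) * p ^ (q + 1 + 1) * r := by
    rw [pow_succ (m : ℝ), pow_succ p (q + 1)]
    linear_combination -(m : ℝ) ^ q * p ^ (q + 1) * hpr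
  have hc' : 0 < (m : ℝ) ^ (q + 1) * p ^ (q + 1 + 1) := by positivity
  have hmul : (m : ℝ) * (p * (m ^ q * p ^ (q + 1) *
      (1 + 2 * r + 4 * (q / m) - 2 * r ^ (q + 1)))) = m ^ (q + 1) * p ^ (q + 1 + 1) *
      (1 + 2 * r + 4 * (q / m) - 2 * r ^ (q + 1)) := by ring
  rw [hmul] at hT
  refine hT.trans ((add_le_add_left ihT _).trans ?_)
  rw [hone, mul_assoc _ r, ← mul_add]
  refine mul_le_mul_of_nonneg_left ?_ hc'.le
  have : r * (r ^ q / p + 4) = r ^ (q + 1) / p + 4 * r := by ring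
  rw [this]
  linarith

variable {Ω : Type*} [MeasurableSpace Ω] {P : Measure Ω} [IsProbabilityMeasure P]

/-- An open layered path exists with high probability. -/
theorem measureReal_no_open_layered_path_le {ι : Type*} {X : ι → Ω → ℝ} (hX : iIndepFun X P)
    (hXm : ∀ i, Measurable (X i)) {τ : ℝ} (hXp : ∀ i, P.real {ω | X i ω ≤ τ} = p)
    (hp : 0 < p) (hm : 0 < m) {q : ℕ} (hq : 1 ≤ q) (hrq : 2 * (1 / (m * p)) + 4 * (q / m) ≤ 1)
    (e : (Fin q → Fin m) → ℕ → ι)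
    (he : ∀ f g, ∀ i < q + 1, ∀ j < q + 1,
      e f i = e g j ↔ i = j ∧ agreeAt True f g i ∧ agreeAt True f g (i + 1)) :
    P.real {ω | ∀ f, ∃ i < q + 1, τ < X (e f i) ω} ≤
      (1 / (m * p)) ^ q / p + 6 * (1 / (m * p)) + 4 * (q / m) := by
  classical
  have : Nonempty (Fin q → Fin m) := ⟨fun _ => ⟨0, hm⟩⟩
  let E : (Fin q → Fin m) → Finset ι := fun f => (Finset.range (q + 1)).image (e f)
  let A : (Fin q → Fin m) → Set Ω := fun f => {ω | ∀ i ∈ E f, X i ω ≤ τ}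
  have hinj : ∀ f, Set.InjOn (e f) (Finset.range (q + 1)) := fun f i hi j hj h => by
    rw [Finset.coe_range, Set.mem_Iio] at hi hj
    exact ((he f f i hi j hj).1 h).1
  have hcard : ∀ f, (E f).card = q + 1 := fun f => by
    rw [Finset.card_image_of_injOn (hinj f), Finset.card_range]
  have hA : ∀ f, MeasurableSet (A f) := fun f => by
    have : A f = ⋂ i ∈ E f, {ω | X i ω ≤ τ} := by
      ext ω
      simp [A]
    rw [this]
    exact Finset.measurableSet_biInter _ fun i _ => measurableSet_le (hXm i) measurable_const
  have h1 : ∀ f, P.real (A f) = p ^ (q + 1) := fun f => by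
    rw [← hcard f]
    exact measureReal_forall_le hX hXp (E f)
  have hpair : ∀ f g, P.real (A f ∩ A g) = p ^ (q + 1) * overlapWeight p True f g := fun f g => by
    have hset : A f ∩ A g = {ω | ∀ i ∈ E f ∪ E g, X i ω ≤ τ} := by
      ext ω
      simp only [A, Set.mem_inter_iff, Set.mem_ofPred_eq, Finset.mem_union]
      constructor
      · rintro ⟨h, h'⟩ i (hi | hi)
        exacts [h i hi, h' i hi]
      · exact fun h => ⟨fun i hi => h i (Or.inl hi), fun i hi => h i (Or.inr hi)⟩
    -- The edges of `g` not already open are those at positions without agreement at both ends; each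
    -- contributes a factor `p`.
    have hsdiff : E g \ E f = ((Finset.range (q + 1)).filter
        fun i => ¬(agreeAt True f g i ∧ agreeAt True f g (i + 1))).image (e g) := by
      ext x
      simp only [E, Finset.mem_sdiff, Finset.mem_image, Finset.mem_range, Finset.mem_filter]
      constructor
      · rintro ⟨⟨j, hj, rfl⟩, h⟩
        refine ⟨j, ⟨hj, fun hag => h ⟨j, hj, ?_⟩⟩, rfl⟩
        exact (he f g j hj j hj).2 ⟨rfl, hag⟩
      · rintro ⟨j, ⟨hj, hag⟩, rfl⟩
        refine ⟨⟨j, hj, rfl⟩, ?_⟩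
        rintro ⟨i, hi, hij⟩
        obtain ⟨rfl, h⟩ := (he f g i hi j hj).1 hij
        exact hag h
    rw [hset, measureReal_forall_le hX hXp, ← Finset.union_sdiff_self_eq_union,
      Finset.card_union_of_disjoint Finset.disjoint_sdiff, hcard, pow_add, hsdiff,
      Finset.card_image_of_injOn ((hinj g).mono fun i hi => ?_), overlapWeight, Finset.prod_ite,
      Finset.prod_const_one, one_mul, Finset.prod_const]
    exact (Finset.mem_filter.1 hi).1
  have h2 : ∀ f, ∑ g, P.real (A f ∩ A g) ≤
      (1 + ((1 / (m * p)) ^ q / p + 6 * (1 / (m * p)) + 4 * (q / m))) *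
        (Fintype.card (Fin q → Fin m) * (p ^ (q + 1)) ^ 2) := fun f => by
    simp_rw [hpair]
    rw [← Finset.mul_sum]
    refine (mul_le_mul_of_nonneg_left (sum_overlapWeight_le hp hm rfl q hq hrq f)
      (by positivity)).trans_eq ?_
    rw [Fintype.card_fun, Fintype.card_fin, Fintype.card_fin]
    push_cast
    ring
  have h3 := measureReal_iInter_compl_le hA (pow_pos hp _) h1 h2
  refine le_trans (measureReal_mono fun ω hω => ?_) h3
  rw [Set.mem_iInter]
  intro f hf
  obtain ⟨i, hi, hlt⟩ := hω f
  exact absurd (hf (e f i) (Finset.mem_image_of_mem _ (Finset.mem_range.2 hi))) (not_le.2 hlt)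

end Layered

/-! ### Realizing layered paths in the complete graph. -/

section LayeredVertices

open SimpleGraph

/-- The vertices of a layered path from `0` to `1`. -/
def layeredVertex {n m q : ℕ} (hn : 2 + q * m ≤ n) (f : Fin q → Fin m) (i : ℕ) : Fin n :=
  match i with
  | 0 => ⟨0, by omega⟩
  -- Layers are consecutive blocks of `m` vertices starting at 2; every position beyond `q` gives
  -- the endpoint 1.
  | i + 1 => if h : i < q then ⟨2 + (i * m + f ⟨i, h⟩), by
      have h1 : i * m + m ≤ q * m := by
        rw [← Nat.succ_mul]
        exact Nat.mul_le_mul_right m h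
      have := (f ⟨i, h⟩).2
      omega⟩ else ⟨1, by omega⟩

variable {n m q : ℕ} (hn : 2 + q * m ≤ n)

/-- The blocks are disjoint, so a vertex reveals its position. Hence two layered paths can share an
edge only at the same position. -/
theorem layeredVertex_eq_iff (f g : Fin q → Fin m) {i j : ℕ} (hi : i ≤ q + 1) (hj : j ≤ q + 1) :
    layeredVertex hn f i = layeredVertex hn g j ↔ i = j ∧ agreeAt True f g i := by
  have key : ∀ {i j a b : ℕ}, a < m → b < m → i * m + a = j * m + b → i = j := by
    intro i j a b ha hb h
    have h1 := congrArg (· / m) h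
    have hm : 0 < m := by omega
    simpa [Nat.add_div_of_dvd_right (Dvd.intro_left _ rfl), Nat.div_eq_of_lt ha,
      Nat.div_eq_of_lt hb, Nat.mul_div_cancel _ hm] using h1
  rcases i with _ | i <;> rcases j with _ | j
  · simp [agreeAt, layeredVertex]
  · simp only [layeredVertex]
    split_ifs
    · simp [Fin.ext_iff]
      omega
    · simp [Fin.ext_iff]
  · simp only [layeredVertex]
    split_ifs <;> simp [Fin.ext_iff]
  · by_cases h1 : i < q <;> by_cases h2 : j < q
    · simp only [layeredVertex, dif_pos h1, dif_pos h2, agreeAt, Fin.mk.injEq]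
      constructor
      · intro h
        have hij : i = j := key (f ⟨i, h1⟩).2 (g ⟨j, h2⟩).2 (by omega)
        subst hij
        exact ⟨rfl, fun _ => Fin.ext (by omega)⟩
      · rintro ⟨hij, h⟩
        obtain rfl : i = j := by omega
        rw [h h1]
    · simp only [layeredVertex, dif_pos h1, dif_neg h2, agreeAt, Fin.mk.injEq]
      constructor <;> intro h <;> omega
    · simp only [layeredVertex, dif_neg h1, dif_pos h2, agreeAt, Fin.mk.injEq]
      constructor <;> intro h <;> omega
    · simp only [layeredVertex, dif_neg h1, dif_neg h2, agreeAt, true_iff]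
      exact ⟨by omega, fun h => absurd h h1⟩

theorem layeredVertex_edge_eq_iff (f g : Fin q → Fin m) {i j : ℕ} (hi : i < q + 1)
    (hj : j < q + 1) :
    s(layeredVertex hn f i, layeredVertex hn f (i + 1)) =
        s(layeredVertex hn g j, layeredVertex hn g (j + 1)) ↔
      i = j ∧ agreeAt True f g i ∧ agreeAt True f g (i + 1) := by
  rw [Sym2.eq_iff]
  simp only [layeredVertex_eq_iff hn _ _ hi.le hj.le, layeredVertex_eq_iff hn _ _ hi hj,
    layeredVertex_eq_iff hn _ _ hi.le hj, layeredVertex_eq_iff hn _ _ hi hj.le]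
  constructor
  · rintro (h | h)
    · tauto
    · omega
  · rintro ⟨rfl, h⟩
    tauto

theorem layeredVertex_injOn (f : Fin q → Fin m) :
    Set.InjOn (layeredVertex hn f) {i | i ≤ q + 1} := fun _ hi _ hj h =>
  ((layeredVertex_eq_iff hn f f hi hj).1 h).1

theorem layeredVertex_adj (f : Fin q → Fin m) {i : ℕ} (hi : i < q + 1) :
    (⊤ : SimpleGraph (Fin n)).Adj (layeredVertex hn f i) (layeredVertex hn f (i + 1)) := by
  rw [top_adj]
  intro h
  have := layeredVertex_injOn hn f hi.le (Nat.succ_le_of_lt hi) h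
  omega

/-- The layered path with given inner vertices. -/
theorem exists_layered_path (h2 : 2 ≤ n) (f : Fin q → Fin m) :
    ∃ p : (⊤ : SimpleGraph (Fin n)).Path ⟨0, by omega⟩ ⟨1, by omega⟩,
      (p : (⊤ : SimpleGraph (Fin n)).Walk ⟨0, by omega⟩ ⟨1, by omega⟩).edges =
        (List.range (q + 1)).map fun i => s(layeredVertex hn f i, layeredVertex hn f (i + 1)) := by
  obtain ⟨w, hw, hw'⟩ := exists_walk_of_seq (layeredVertex hn f) (q + 1)
    fun i hi => layeredVertex_adj hn f hi
  have h1 : layeredVertex hn f (q + 1) = ⟨1, by omega⟩ := by simp [layeredVertex]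
  have hpath : w.IsPath := by
    rw [Walk.isPath_def, hw]
    refine List.Nodup.map_on (fun i hi j hj h => ?_) List.nodup_range
    rw [List.mem_range] at hi hj
    exact layeredVertex_injOn hn f (Nat.lt_succ_iff.1 hi) (Nat.lt_succ_iff.1 hj) h
  have h0 : layeredVertex hn f 0 = ⟨0, by omega⟩ := rfl
  exact ⟨⟨w.copy h0 h1, (Walk.isPath_copy w h0 h1).2 hpath⟩, (Walk.edges_copy w h0 h1).trans hw'⟩

end LayeredVertices

/-! ### The distribution function near zero. -/

section Distribution

variable {Ω : Type*} [MeasurableSpace Ω] {P : Measure Ω} [IsProbabilityMeasure P] {Z : Ω → ℝ}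

theorem cdf_map_eq_measureReal (hZ : AEMeasurable Z P) (x : ℝ) :
    cdf (P.map Z) x = P.real {ω | Z ω ≤ x} := by
  have := Measure.isProbabilityMeasure_map hZ
  rw [cdf_eq_real, map_measureReal_apply_of_aemeasurable hZ measurableSet_Iic]
  rfl

/-- A random variable with continuous distribution function has no atoms. -/
theorem measure_eq_zero_of_continuous_cdf (hZ : AEMeasurable Z P)
    (hcont : Continuous (cdf (P.map Z))) (y : ℝ) : P {ω | Z ω = y} = 0 := by
  have := Measure.isProbabilityMeasure_map hZ
  have h : P.map Z {y} = 0 := by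
    rw [← measure_cdf (P.map Z), StieltjesFunction.measure_singleton,
      (hcont.continuousAt.continuousWithinAt).leftLim_eq, sub_self, ENNReal.ofReal_zero]
  rwa [Measure.map_apply_of_aemeasurable hZ (measurableSet_singleton y)] at h

/-- Linear bounds near zero from a positive one-sided derivative. -/
theorem exists_linear_bounds {G : ℝ → ℝ} {lam : ℝ} (hlam : 0 < lam) (h0 : G 0 = 0)
    (h1 : ∀ x, G x ≤ 1) (hG : HasDerivWithinAt G lam (Set.Ici 0) 0) :
    ∃ c C x₀ : ℝ, 0 < c ∧ 0 < C ∧ 0 < x₀ ∧ (∀ x, 0 ≤ x → G x ≤ C * x) ∧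
      ∀ x, 0 ≤ x → x ≤ x₀ → c * x ≤ G x := by
  have hlo := (hasDerivWithinAt_iff_isLittleO.1 hG).def (half_pos hlam)
  obtain ⟨d, hd, hball⟩ := Metric.mem_nhdsWithin_iff.1 hlo
  have hx : ∀ x, 0 ≤ x → x < d → |G x - x * lam| ≤ lam / 2 * x := fun x hx0 hxd => by
    have : x ∈ Metric.ball (0 : ℝ) d ∩ Set.Ici 0 := by
      refine ⟨?_, hx0⟩
      rwa [Metric.mem_ball, Real.dist_eq, sub_zero, abs_of_nonneg hx0]
    have := hball this
    simpa [h0, abs_of_nonneg hx0] using this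
  -- Below `d` the slope of `G` is within `lam / 2` of `lam`; from `d` on, `G ≤ 1 ≤ x / d` suffices.
  refine ⟨lam / 2, 3 * lam / 2 + 2 / d, d / 2, by positivity, by positivity, by positivity,
    fun x hx0 => ?_, fun x hx0 hxd => ?_⟩
  · have h2 : 0 ≤ 2 / d * x := by positivity
    have h3 : 0 ≤ lam * x := by positivity
    rcases lt_or_ge x d with hxd | hxd
    · have := (abs_le.1 (hx x hx0 hxd)).2
      nlinarith
    · have h4 : 2 / d * d ≤ 2 / d * x := by gcongr
      rw [div_mul_cancel₀ _ hd.ne'] at h4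
      have := h1 x
      nlinarith
  · have := (abs_le.1 (hx x hx0 (by linarith))).1
    linarith

end Distribution

/-! ### Union bound over light paths, and absence of ties. -/

section UnionBound

open SimpleGraph

variable {Ω : Type*} [MeasurableSpace Ω] {P : Measure Ω} {n : ℕ}
  {G : SimpleGraph (Fin n)} [Fintype G.edgeSet] {X : G.edgeSet → Ω → ℝ}

open Classical in
/-- The set of edges of a path, as a finite set of edges of the graph. -/
noncomputable def pathEdges {u v : Fin n} (q : G.Path u v) : Finset G.edgeSet :=
  Finset.univ.filter fun e => (e : Sym2 (Fin n)) ∈ (q : G.Walk u v).edges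

theorem card_pathEdges {u v : Fin n} (q : G.Path u v) :
    (pathEdges q).card = (q : G.Walk u v).length := by
  rw [← card_filter_mem_edges q]
  congr 1
  ext e
  simp [pathEdges]

theorem pathWeight_eq_sum_pathEdges (w : Sym2 (Fin n) → ℝ) {u v : Fin n} (q : G.Path u v) :
    pathWeight w q = ∑ e ∈ pathEdges q, w e := by
  rw [pathWeight_eq_sum w q]
  refine Finset.sum_congr ?_ fun _ _ => rfl
  ext e
  simp [pathEdges]

theorem mem_pathEdges {u v : Fin n} (q : G.Path u v) (e : G.edgeSet) :
    e ∈ pathEdges q ↔ (e : Sym2 (Fin n)) ∈ (q : G.Walk u v).edges := by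
  simp [pathEdges]

/-- The first moment method for light paths whose length is not `K`. -/
theorem measureReal_exists_light_path_le (hX : iIndepFun X P) (hm : ∀ e, Measurable (X e))
    (hpos : ∀ e, ∀ᵐ ω ∂P, 0 < X e ω) {b M t y : ℝ} (hb : 0 < b) (hM0 : 0 ≤ M)
    (hM : ∀ e, ∫⁻ ω, ENNReal.ofReal (X e ω ^ (-b)) ∂P ≤ ENNReal.ofReal M) (ht : 0 < t)
    (hy0 : 0 ≤ y) (hy1 : y < 1) {K : ℕ}
    (hk : ∀ k : ℕ, 1 ≤ k → k ≠ K → (n : ℝ) ^ (k - 1) * ((t / k) ^ (k * b) * M ^ k) ≤ y ^ k)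
    {u v : Fin n} (huv : u ≠ v) :
    P.real {ω | ∃ q : G.Path u v, (q : G.Walk u v).length ≠ K ∧
      ∑ e ∈ pathEdges q, X e ω ≤ t} ≤ y / (1 - y) := by
  classical
  let g : ℕ → ℝ := fun k => (t / k) ^ (k * b) * M ^ k
  let len : G.Path u v → ℕ := fun q => (q : G.Walk u v).length
  have hg0 : ∀ k, 0 ≤ g k := fun k => by positivity
  have hlen : ∀ q, 1 ≤ len q ∧ len q < n := fun q => by
    constructor
    · by_contra h
      exact huv (Walk.eq_of_length_eq_zero (p := (q : G.Walk u v)) (by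
        change len q = 0
        omega))
    · simpa using q.2.length_lt
  have hone : ∀ q : G.Path u v, P.real {ω | ∑ e ∈ pathEdges q, X e ω ≤ t} ≤ g (len q) := fun q => by
    have hne : (pathEdges q).Nonempty := by
      rw [← Finset.card_pos, card_pathEdges]
      exact (hlen q).1
    have h := measure_sum_le_le hX hm hpos hb hM (pathEdges q) hne ht
    rw [card_pathEdges, ← ENNReal.ofReal_pow hM0, ← ENNReal.ofReal_mul (by positivity)] at h
    exact ENNReal.toReal_le_of_le_ofReal (hg0 _) h
  let S : Finset (G.Path u v) := Finset.univ.filter fun q => len q ≠ K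
  have hset : {ω | ∃ q : G.Path u v, (q : G.Walk u v).length ≠ K ∧
      ∑ e ∈ pathEdges q, X e ω ≤ t} = ⋃ q ∈ S, {ω | ∑ e ∈ pathEdges q, X e ω ≤ t} := by
    ext ω
    simp [S, len]
  let T : Finset ℕ := (Finset.Ico 1 n).filter fun k => k ≠ K
  have hmaps : ∀ q ∈ S, len q ∈ T := fun q hq => by
    simp only [S, T, Finset.mem_filter, Finset.mem_univ, true_and, Finset.mem_Ico] at hq ⊢
    exact ⟨hlen q, hq⟩
  rw [hset]
  calc P.real (⋃ q ∈ S, {ω | ∑ e ∈ pathEdges q, X e ω ≤ t})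
      ≤ ∑ q ∈ S, P.real {ω | ∑ e ∈ pathEdges q, X e ω ≤ t} := measureReal_biUnion_finset_le _ _
    _ ≤ ∑ q ∈ S, g (len q) := Finset.sum_le_sum fun q _ => hone q
    _ = ∑ k ∈ T, ∑ q ∈ S with len q = k, g (len q) := (Finset.sum_fiberwise_of_maps_to hmaps _).symm
    _ ≤ ∑ k ∈ T, y ^ k := by
        refine Finset.sum_le_sum fun k hkT => ?_
        simp only [T, Finset.mem_filter, Finset.mem_Ico] at hkT
        have h1 : ∑ q ∈ S with len q = k, g (len q) = (S.filter fun q => len q = k).card * g k := by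
          rw [← nsmul_eq_mul]
          exact Finset.sum_eq_card_nsmul fun q hq => by rw [(Finset.mem_filter.1 hq).2]
        rw [h1]
        refine le_trans (mul_le_mul_of_nonneg_right ?_ (hg0 k)) (hk k hkT.1.1 hkT.2)
        have h2 : (S.filter fun q => len q = k).card ≤ n ^ (k - 1) :=
          (Finset.card_le_card (Finset.filter_subset_filter _ (Finset.filter_subset _ _))).trans
            (card_path_length_le u v k)
        exact_mod_cast h2
    _ ≤ ∑ k ∈ Finset.Ico 1 n, y ^ k :=
        Finset.sum_le_sum_of_subset_of_nonneg (Finset.filter_subset _ _) fun k _ _ => by positivity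
    _ ≤ y / (1 - y) := by simpa using geom_sum_Ico_le_of_lt_one (m := 1) (n := n) hy0 hy1

/-- Almost surely, no two paths have equal weights. -/
theorem ae_forall_sum_pathEdges_ne [IsProbabilityMeasure P] (hX : iIndepFun X P) (hm : ∀ e, Measurable (X e))
    (hatom : ∀ e y, P (X e ⁻¹' {y}) = 0) {u v : Fin n} :
    ∀ᵐ ω ∂P, ∀ p q : G.Path u v, p ≠ q →
      ∑ e ∈ pathEdges p, X e ω ≠ ∑ e ∈ pathEdges q, X e ω := by
  classical
  rw [ae_all_iff]
  intro p
  rw [ae_all_iff]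
  intro q
  by_cases hpq : p = q
  · simp [hpq]
  -- Such an edge has coefficient 1 in the difference of the two weights, so its law, having no
  -- atoms, rules out a tie.
  obtain ⟨e, hep, heq⟩ : ∃ e ∈ pathEdges p, e ∉ pathEdges q := by
    by_contra! h
    refine hpq (Subtype.ext (Walk.IsPath.eq_of_edges_subset p.2 q.2 fun e he => ?_))
    have := h ⟨e, (p : G.Walk u v).edges_subset_edgeSet he⟩ ((mem_pathEdges _ _).2 he)
    exact (mem_pathEdges _ _).1 this
  let c : G.edgeSet → ℝ := fun i => (if i ∈ pathEdges p then 1 else 0) -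
    if i ∈ pathEdges q then 1 else 0
  have h0 := measure_sum_mul_eq_zero hX hm c e (by simp [c, hep, heq]) (hatom e)
  have hsum : ∀ ω, ∑ i, c i * X i ω =
      ∑ i ∈ pathEdges p, X i ω - ∑ i ∈ pathEdges q, X i ω := fun ω => by
    simp [c, sub_mul, Finset.sum_sub_distrib, ite_mul]
  rw [← compl_compl {ω | ∑ i, c i * X i ω = 0}, ← mem_ae_iff] at h0
  filter_upwards [h0] with ω hω _ heq'
  exact hω (by change ∑ i, c i * X i ω = 0; rw [hsum, heq', sub_self])

end UnionBound

/-! ### Explicit bounds for the first and second moment errors. -/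

section Estimates

/-- A quantitative form of `log x ≤ x - 1` at ratios of natural numbers. -/
theorem log_div_le_of_ne {K k : ℕ} (hK : 1 ≤ K) (hk : 1 ≤ k) (hne : k ≠ K) :
    Real.log ((K : ℝ) / k) ≤ (K : ℝ) / k - 1 - 1 / (12 * (K : ℝ) ^ 2) := by
  have hK1 : (1 : ℝ) ≤ K := by exact_mod_cast hK
  have hk1 : (1 : ℝ) ≤ k := by exact_mod_cast hk
  -- Integrality enters here and produces the gap.
  have hd : (1 : ℝ) ≤ ((K : ℝ) - k) ^ 2 := by
    have h : (1 : ℤ) ≤ ((K : ℤ) - k) ^ 2 := by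
      have : 0 < ((K : ℤ) - k) ^ 2 := by
        have : (K : ℤ) - k ≠ 0 := by omega
        positivity
      omega
    exact_mod_cast h
  have hmain : (k : ℝ) * (K + k) ≤ 6 * K ^ 2 * ((K : ℝ) - k) ^ 2 := by
    rcases le_or_gt (k : ℝ) (2 * K) with h | h
    · have h1 : (k : ℝ) * (K + k) ≤ 6 * K ^ 2 := by nlinarith
      have h2 : 6 * (K : ℝ) ^ 2 * 1 ≤ 6 * K ^ 2 * ((K : ℝ) - k) ^ 2 := by gcongr
      linarith
    · have h1 : (k : ℝ) ^ 2 / 4 ≤ ((K : ℝ) - k) ^ 2 := by nlinarith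
      have h2 : 6 * (1 : ℝ) ^ 2 * ((k : ℝ) ^ 2 / 4) ≤ 6 * K ^ 2 * ((K : ℝ) - k) ^ 2 := by gcongr
      nlinarith
  set x : ℝ := (K : ℝ) / k with hx
  have hx0 : 0 < x := by positivity
  -- Since `2(√x - 1) = x - 1 - (√x - 1)²`, it remains to bound `(√x - 1)²` from below.
  have hlog : Real.log x ≤ 2 * (√x - 1) := by
    have h1 := Real.log_le_sub_one_of_pos (Real.sqrt_pos.2 hx0)
    rw [Real.log_sqrt hx0.le] at h1
    linarith
  have hsq : √x ^ 2 = x := Real.sq_sqrt hx0.le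
  have h1 : 1 / (12 * (K : ℝ) ^ 2) ≤ (√x - 1) ^ 2 := by
    have h2 : (x - 1) ^ 2 ≤ (√x - 1) ^ 2 * (2 * (x + 1)) := by
      have h3 : (x - 1) ^ 2 = (√x - 1) ^ 2 * (√x + 1) ^ 2 := by
        rw [← mul_pow]
        congr 1
        linear_combination -hsq
      rw [h3]
      refine mul_le_mul_of_nonneg_left ?_ (sq_nonneg _)
      nlinarith [sq_nonneg (√x - 1)]
    have h4 : x + 1 ≤ 6 * K ^ 2 * (x - 1) ^ 2 := by
      have h5 : x + 1 = k * (K + k) / (k : ℝ) ^ 2 := by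
        rw [hx]
        field_simp
      have h6 : 6 * (K : ℝ) ^ 2 * (x - 1) ^ 2 = 6 * K ^ 2 * ((K : ℝ) - k) ^ 2 / (k : ℝ) ^ 2 := by
        rw [hx]
        field_simp
      rw [h5, h6]
      gcongr
    rw [div_le_iff₀ (by positivity)]
    have h7 : x + 1 ≤ 6 * K ^ 2 * ((√x - 1) ^ 2 * (2 * (x + 1))) := h4.trans (by gcongr)
    have h8 : 0 < x + 1 := by linarith
    nlinarith
  nlinarith

/-- The expected number of light paths with `k` edges. -/
theorem expected_light_paths_le {n K k : ℕ} {s C η : ℝ} (hn : 2 ≤ n) (hK : 1 ≤ K) (hk : 1 ≤ k)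
    (hne : k ≠ K) (hs : 0 < s) (hKs : (K : ℝ) = s * Real.log n) (hL : 2 ≤ Real.log n) (hC : 0 < C)
    (hη : 0 ≤ η)
    (herr : s + η + s * Real.log (1 + C * Real.log n) ≤ 1 / (48 * (K : ℝ) ^ 2)) :
    (n : ℝ) ^ (k - 1) * ((K * Real.exp (1 - K + η) / k) ^ (k * ((1 - 1 / Real.log n) / s)) *
      (1 + C * Real.log n) ^ k) ≤ Real.exp (-(1 / (48 * (s * (K : ℝ) ^ 2)))) ^ k := by
  set L := Real.log n with hLdef
  have hK0 : (0 : ℝ) < K := by exact_mod_cast hK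
  have hk0 : (0 : ℝ) < k := by exact_mod_cast hk
  have hL0 : 0 < L := by linarith
  have hn0 : (0 : ℝ) < n := by positivity
  have hM : 0 < 1 + C * L := by positivity
  -- Taking `a` slightly below 1 costs `K / L = s` in the exponent, while the moment bound `1 + C L`
  -- costs only `s log(1 + C L)`.
  set a := 1 - 1 / L with ha
  have hδ : 1 / L ≤ 1 / 2 := one_div_le_one_div_of_le (by norm_num) hL
  have hδ0 : 0 < 1 / L := by positivity
  have hδK : 1 / L * K = s := by rw [hKs]; field_simp
  have hLs : L = K / s := by rw [hKs]; field_simp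
  set u := Real.log ((K : ℝ) / k) with hu
  have hbase : K * Real.exp (1 - K + η) / k = Real.exp (u + (1 - K + η)) := by
    rw [Real.exp_add u, hu, Real.exp_log (by positivity)]
    ring
  have hn1 : (n : ℝ) ^ (k - 1) = Real.exp ((k - 1) * L) := by
    rw [show ((k : ℝ) - 1) = ((k - 1 : ℕ) : ℝ) by push_cast [hk]; ring, Real.exp_nat_mul, hLdef,
      Real.exp_log hn0]
  have hM1 : (1 + C * L) ^ k = Real.exp (k * Real.log (1 + C * L)) := by
    rw [Real.exp_nat_mul, Real.exp_log hM]
  rw [hbase, hn1, hM1, ← Real.exp_mul, ← Real.exp_add, ← Real.exp_add, ← Real.exp_nat_mul]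
  refine Real.exp_le_exp.2 ?_
  have hlog := log_div_le_of_ne hK hk hne
  rw [← hu] at hlog
  set x := (K : ℝ) / k with hx
  have hx0 : 0 < x := by positivity
  -- The full exponent is `k / s` times this bracket. Of the gap `1/(12 K²)`, at most half is lost
  -- to `a ≥ 1/2` and a quarter to `herr`, so a quarter remains.
  have hbr : K - x + a * (u + (1 - K + η)) + s * Real.log (1 + C * L) ≤
      -(1 / (48 * (K : ℝ) ^ 2)) := by
    have hK2 : 1 / (48 * (K : ℝ) ^ 2) = 1 / (12 * (K : ℝ) ^ 2) / 4 := by ring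
    have hp : 0 < 1 / (12 * (K : ℝ) ^ 2) := by positivity
    have h1 : a * u ≤ a * (x - 1 - 1 / (12 * (K : ℝ) ^ 2)) :=
      mul_le_mul_of_nonneg_left hlog (by linarith)
    have h2 : 1 / 2 * (1 / (12 * (K : ℝ) ^ 2)) ≤ a * (1 / (12 * (K : ℝ) ^ 2)) :=
      mul_le_mul_of_nonneg_right (by linarith) hp.le
    have h3 : a * η ≤ η := mul_le_of_le_one_left hη (by linarith)
    have h4 : 0 < 1 / L * x := by positivity
    rw [hK2] at herr ⊢
    have h5 : K - x + a * (x - 1 - 1 / (12 * (K : ℝ) ^ 2) + (1 - K)) =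
        1 / L * K - 1 / L * x - a * (1 / (12 * (K : ℝ) ^ 2)) := by rw [ha]; ring
    have h6 : a * (u + (1 - K + η)) = a * u + a * (1 - K) + a * η := by ring
    have h7 : a * (x - 1 - 1 / (12 * (K : ℝ) ^ 2) + (1 - K)) =
      a * (x - 1 - 1 / (12 * (K : ℝ) ^ 2)) + a * (1 - K) := by ring
    linarith
  have hfin := mul_le_mul_of_nonneg_left hbr (show 0 ≤ (k : ℝ) / s by positivity)
  calc ((k : ℝ) - 1) * L + ((u + (1 - K + η)) * (k * (a / s)) + k * Real.log (1 + C * L))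
      = k / s * (K - x + a * (u + (1 - K + η)) + s * Real.log (1 + C * L)) := by
        rw [hLs, hx]
        field_simp
        ring
    _ ≤ k / s * -(1 / (48 * (K : ℝ) ^ 2)) := hfin
    _ = k * -(1 / (48 * (s * (K : ℝ) ^ 2))) := by field_simp

/-- The failure probability in the second moment bound for layered paths is small. -/
theorem layered_error_le {n K : ℕ} {s c p : ℝ} (hK : 2 ≤ K) (hs : 0 < s)
    (hKs : (K : ℝ) = s * Real.log n) (hKL : (K : ℝ) ≤ Real.log n) (hL : 10 ≤ Real.log n)
    (hcL : 2 ≤ c * Real.log n) (hn : 2 * Real.log n + 4 ≤ n) (hn3 : Real.log n ^ 3 ≤ n)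
    (hp : c * Real.exp ((1 - K + 3 * s * Real.log (Real.log n)) / s) ≤ p) :
    ∃ m : ℕ, 0 < m ∧ 2 + (K - 1) * m ≤ n ∧ 0 < p ∧
      2 * (1 / (m * p)) + 4 * (((K - 1 : ℕ) : ℝ) / m) ≤ 1 ∧
      (1 / (m * p)) ^ (K - 1) / p + 6 * (1 / (m * p)) + 4 * (((K - 1 : ℕ) : ℝ) / m) ≤
        15 / Real.log n := by
  set L := Real.log n with hLdef
  have hL0 : 0 < L := by linarith
  have hK2 : (2 : ℝ) ≤ K := by exact_mod_cast hK
  have hn0 : (0 : ℝ) < n := by linarith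
  have hn2 : 2 ≤ n := by
    have : (2 : ℝ) ≤ n := by linarith
    exact_mod_cast this
  set m := (n - 2) / (K - 1) with hm
  have hq : (((K - 1 : ℕ)) : ℝ) = K - 1 := by push_cast [show 1 ≤ K by omega]; ring
  have hmlow : (n : ℝ) / (2 * K) ≤ m := by
    have h1 : n - 2 < (K - 1) * (m + 1) := Nat.lt_mul_div_succ (n - 2) (by omega)
    have h2 : (n : ℝ) - 2 ≤ (K - 1) * (m + 1) := by
      have h3 : ((n - 2 : ℕ) : ℝ) ≤ ((K - 1 : ℕ) : ℝ) * (m + 1) := by exact_mod_cast h1.le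
      rw [hq] at h3
      push_cast [hn2] at h3
      exact h3
    rw [div_le_iff₀ (by positivity)]
    have h4 : (0 : ℝ) ≤ m := Nat.cast_nonneg m
    nlinarith
  have hm0 : (0 : ℝ) < m := lt_of_lt_of_le (by positivity) hmlow
  have hc : 0 < c := by
    by_contra h
    nlinarith
  have hLs : L = K / s := by rw [hKs]; field_simp
  -- Here `exp(-K/s) = 1/n`, and the shift `3 s log L` supplies the factor `L³`.
  have hexp : Real.exp ((1 - K + 3 * s * Real.log L) / s) = Real.exp (1 / s) * L ^ 3 / n := by
    have h1 : (1 - K + 3 * s * Real.log L) / s = 1 / s + (3 : ℕ) * Real.log L - L := by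
      rw [hLs]
      field_simp
      push_cast
      ring
    rw [h1, Real.exp_sub, Real.exp_add, Real.exp_nat_mul, Real.exp_log hL0, hLdef,
      Real.exp_log hn0]
  rw [hexp] at hp
  have hp0 : 0 < p := lt_of_lt_of_le (by positivity) hp
  -- Of the three powers of `L`, one compensates `c` and one the division into about `K ≤ L` layers.
  have hmp : L * Real.exp (1 / s) ≤ m * p := by
    have h1 : (n : ℝ) / (2 * K) * (c * (Real.exp (1 / s) * L ^ 3 / n)) ≤ m * p := by gcongr
    have h2 : (n : ℝ) / (2 * K) * (c * (Real.exp (1 / s) * L ^ 3 / n)) =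
        c * L * L ^ 2 * Real.exp (1 / s) / (2 * K) := by field_simp
    rw [h2] at h1
    refine le_trans ?_ h1
    rw [le_div_iff₀ (by positivity)]
    calc L * Real.exp (1 / s) * (2 * K) ≤ L * Real.exp (1 / s) * (2 * L) := by gcongr
      _ = 2 * L ^ 2 * Real.exp (1 / s) := by ring
      _ ≤ c * L * L ^ 2 * Real.exp (1 / s) := by gcongr
  have hexp1 : 1 ≤ Real.exp (1 / s) := Real.one_le_exp (by positivity)
  have hr : 1 / (m * p) ≤ 1 / (L * Real.exp (1 / s)) :=
    one_div_le_one_div_of_le (by positivity) hmp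
  have hrL : 1 / (m * p) ≤ 1 / L := hr.trans
    (one_div_le_one_div_of_le hL0 (le_mul_of_one_le_right hL0.le hexp1))
  have hqm : ((K - 1 : ℕ) : ℝ) / m ≤ 2 / L := by
    rw [div_le_div_iff₀ hm0 hL0, hq]
    rw [div_le_iff₀ (by positivity)] at hmlow
    have h1 : (K : ℝ) * (K * L) ≤ L * (L * L) := by gcongr
    have h3 : (K : ℝ) * (K * L) ≤ K * (2 * m) := by nlinarith
    have h4 := le_of_mul_le_mul_left h3 (by linarith)
    nlinarith
  -- The quantity equals `m (1/(m p))^K`; the factor `m ≤ n` is cancelled by `exp(1/s)^K = n`.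
  have hlast : (1 / (m * p)) ^ (K - 1) / p ≤ 1 / L := by
    have h1 : (1 / (m * p)) ^ (K - 1) / p = m * (1 / (m * p)) ^ K := by
      obtain ⟨q, rfl⟩ : ∃ q, K = q + 1 := ⟨K - 1, by omega⟩
      rw [Nat.add_sub_cancel, pow_succ]
      field_simp
    have hmn : (m : ℝ) ≤ n := by
      exact_mod_cast (Nat.div_le_self _ _).trans (Nat.sub_le _ _)
    have hne : Real.exp (1 / s) ^ K = n := by
      rw [← Real.exp_nat_mul, mul_one_div, ← hLs, hLdef, Real.exp_log hn0]
    rw [h1]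
    calc m * (1 / (m * p)) ^ K ≤ n * (1 / (L * Real.exp (1 / s))) ^ K := by gcongr
      _ = (1 / L) ^ K := by
        rw [one_div_pow, mul_pow, hne, one_div_pow]
        field_simp
      _ ≤ (1 / L) ^ 1 := pow_le_pow_of_le_one (by positivity)
          (by rw [div_le_one hL0]; linarith) (by omega)
      _ = 1 / L := pow_one _
  -- The total is `1 + 6 + 4 · 2 = 15`.
  have hL15 : 15 / L = 15 * (1 / L) := by ring
  have hL2 : 2 / L = 2 * (1 / L) := by ring
  have hL10 : 1 / L ≤ 1 / 10 := one_div_le_one_div_of_le (by norm_num) hL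
  refine ⟨m, by exact_mod_cast hm0, ?_, hp0, by linarith, by linarith⟩
  have := Nat.mul_div_le (n - 2) (K - 1)
  rw [← hm] at this
  omega

end Estimates

/-! ### The hopcount bound for fixed `n`. -/

section Hopcount

open SimpleGraph

variable {Ω : Type*} [MeasurableSpace Ω] {P : Measure Ω} [IsProbabilityMeasure P] {n : ℕ}

/-- With high probability there is a path with `K` edges, all of whose weights are at most `τ`. -/
theorem measureReal_no_open_path_le [Fintype (⊤ : SimpleGraph (Fin n)).edgeSet]
    {X : (⊤ : SimpleGraph (Fin n)).edgeSet → Ω → ℝ} (hX : iIndepFun X P)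
    (hm : ∀ e, Measurable (X e)) {τ p : ℝ} (hXp : ∀ e, P.real {ω | X e ω ≤ τ} = p) (hp : 0 < p)
    {K m : ℕ} (hK : 2 ≤ K) (hm0 : 0 < m) (hn : 2 + (K - 1) * m ≤ n) (h2 : 2 ≤ n)
    (hrq : 2 * (1 / (m * p)) + 4 * (((K - 1 : ℕ) : ℝ) / m) ≤ 1) :
    P.real {ω | ∀ q : (⊤ : SimpleGraph (Fin n)).Path ⟨0, by omega⟩ ⟨1, by omega⟩,
      K * τ < ∑ e ∈ pathEdges q, X e ω} ≤
      (1 / (m * p)) ^ (K - 1) / p + 6 * (1 / (m * p)) + 4 * (((K - 1 : ℕ) : ℝ) / m) := by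
  classical
  let e : (Fin (K - 1) → Fin m) → ℕ → (⊤ : SimpleGraph (Fin n)).edgeSet := fun f i =>
    if h : i < K - 1 + 1 then
      ⟨s(layeredVertex hn f i, layeredVertex hn f (i + 1)), layeredVertex_adj hn f h⟩
    else ⟨s(layeredVertex hn f 0, layeredVertex hn f (0 + 1)),
      layeredVertex_adj hn f (Nat.succ_pos _)⟩
  have he : ∀ f g, ∀ i < K - 1 + 1, ∀ j < K - 1 + 1,
      e f i = e g j ↔ i = j ∧ agreeAt True f g i ∧ agreeAt True f g (i + 1) := by
    intro f g i hi j hj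
    simp only [e, dif_pos hi, dif_pos hj]
    rw [Subtype.ext_iff]
    exact layeredVertex_edge_eq_iff hn f g hi hj
  refine le_trans (measureReal_mono fun ω hω => ?_)
    (measureReal_no_open_layered_path_le hX hm hXp hp hm0 (by omega) hrq e he)
  intro f
  by_contra! hcon
  obtain ⟨q, hq⟩ := exists_layered_path hn h2 f
  refine absurd (hω q) (not_lt.2 ?_)
  have hcard : (pathEdges q).card = K := by
    rw [card_pathEdges, ← Walk.length_edges, hq, List.length_map, List.length_range]
    omega
  rw [← hcard, ← nsmul_eq_mul]
  refine Finset.sum_le_card_nsmul _ _ _ fun d hd => ?_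
  rw [mem_pathEdges, hq, List.mem_map] at hd
  obtain ⟨i, hi, hid⟩ := hd
  rw [List.mem_range] at hi
  have hd' : d = e f i := by
    simp only [e, dif_pos hi]
    exact Subtype.ext hid.symm
  rw [hd']
  exact hcon i hi

/-- The probability that the hopcount is `K`, for a given number of vertices. -/
theorem le_measureReal_completeHopcount_eq {Ω₀ : Type*} [MeasurableSpace Ω₀] {P₀ : Measure Ω₀}
    [IsProbabilityMeasure P₀] {Z : Ω₀ → ℝ} (hZ : AEMeasurable Z P₀) (hZpos : ∀ᵐ ω ∂P₀, 0 < Z ω)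
    (hZatom : ∀ y, P₀ {ω | Z ω = y} = 0) {c C x₀ : ℝ} (hC : 0 < C)
    (hup : ∀ x, 0 ≤ x → P₀.real {ω | Z ω ≤ x} ≤ C * x)
    (hlow : ∀ x, 0 ≤ x → x ≤ x₀ → c * x ≤ P₀.real {ω | Z ω ≤ x})
    {X : Sym2 (Fin n) → Ω → ℝ} {s : ℝ} (hs : 0 < s)
    (hXindep : iIndepFun (fun e : (⊤ : SimpleGraph (Fin n)).edgeSet => X e) P)
    (hXlaw : ∀ e ∈ (⊤ : SimpleGraph (Fin n)).edgeSet,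
      IdentDistrib (X e) (fun ω => Z ω ^ s) P P₀)
    {K : ℕ} (hK : 2 ≤ K) (hKs : (K : ℝ) = s * Real.log n) (hKL : (K : ℝ) ≤ Real.log n)
    (hL : 10 ≤ Real.log n) (hcL : 2 ≤ c * Real.log n) (hn : 2 * Real.log n + 4 ≤ n)
    (hn3 : Real.log n ^ 3 ≤ n)
    (hx₀ : Real.exp ((1 - K + 3 * s * Real.log (Real.log n)) / s) ≤ x₀)
    (herr : s + 3 * s * Real.log (Real.log n) + s * Real.log (1 + C * Real.log n) ≤
      1 / (48 * (K : ℝ) ^ 2)) {y : ℝ} (hy : y = Real.exp (-(1 / (48 * (s * (K : ℝ) ^ 2))))) :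
    1 - (y / (1 - y) + 15 / Real.log n) ≤
      P.real {ω | completeHopcount n (fun e => X e ω) = K} := by
  classical
  have hn2 : 2 ≤ n := by
    have : (2 : ℝ) ≤ n := by linarith
    exact_mod_cast this
  have hL0 : 0 < Real.log n := by linarith
  have hLL : 0 ≤ Real.log (Real.log n) := Real.log_nonneg (by linarith)
  have hK0 : (0 : ℝ) < K := by
    have : 0 < K := by omega
    exact_mod_cast this
  set η : ℝ := 3 * s * Real.log (Real.log n) with hη
  set τ : ℝ := Real.exp (1 - K + η) with hτ
  -- Measurable versions of the weights, almost surely equal to them on all the finitely many edges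
  -- at once.
  let Y : (⊤ : SimpleGraph (Fin n)).edgeSet → Ω → ℝ := fun e =>
    (hXlaw e e.2).aemeasurable_fst.mk (X e)
  have hYm : ∀ e, Measurable (Y e) := fun e => (hXlaw e e.2).aemeasurable_fst.measurable_mk
  have hYX : ∀ e : (⊤ : SimpleGraph (Fin n)).edgeSet, X e =ᵐ[P] Y e := fun e =>
    (hXlaw e e.2).aemeasurable_fst.ae_eq_mk
  have hY : iIndepFun Y P := hXindep.congr hYX
  have hlaw : ∀ e, IdentDistrib (Y e) (fun ω => Z ω ^ s) P P₀ := fun e =>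
    (IdentDistrib.of_ae_eq (hYm e).aemeasurable (hYX e).symm).trans (hXlaw e e.2)
  have hYpos : ∀ e, ∀ᵐ ω ∂P, 0 < Y e ω := fun e =>
    (hlaw e).symm.ae_snd (p := fun x => 0 < x) measurableSet_Ioi
      (hZpos.mono fun ω h => Real.rpow_pos_of_pos h s)
  have hYatom : ∀ e y, P (Y e ⁻¹' {y}) = 0 := fun e y => by
    rw [(hlaw e).measure_preimage_eq (measurableSet_singleton y)]
    refine measure_mono_null_ae ?_ (hZatom (y ^ s⁻¹))
    filter_upwards [hZpos] with ω hω h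
    replace h : Z ω ^ s = y := h
    change Z ω = y ^ s⁻¹
    rw [← h, ← Real.rpow_mul hω.le, mul_inv_cancel₀ hs.ne', Real.rpow_one]
  have hYp : ∀ e, P.real {ω | Y e ω ≤ τ} = P₀.real {ω | Z ω ≤ Real.exp ((1 - K + η) / s)} := by
    intro e
    rw [measureReal_def, measureReal_def]
    congr 1
    refine ((hlaw e).measure_preimage_eq (measurableSet_Iic (a := τ))).trans ?_
    refine measure_congr ?_
    filter_upwards [hZpos] with ω hω
    refine propext ?_
    change Z ω ^ s ≤ τ ↔ Z ω ≤ Real.exp ((1 - K + η) / s)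
    rw [div_eq_mul_inv, Real.exp_mul, ← hτ]
    exact (Real.le_rpow_inv_iff_of_pos hω.le (Real.exp_pos _).le hs).symm
  have ha0 : 0 < 1 - 1 / Real.log n := by
    have : 1 / Real.log n ≤ 1 / 10 := one_div_le_one_div_of_le (by norm_num) hL
    linarith
  have ha1 : 1 - 1 / Real.log n < 1 := by
    have : 0 < 1 / Real.log n := by positivity
    linarith
  have hYmom : ∀ e, ∫⁻ ω, ENNReal.ofReal (Y e ω ^ (-((1 - 1 / Real.log n) / s))) ∂P ≤
      ENNReal.ofReal (1 + C * Real.log n) := fun e => by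
    have h1 := ((hlaw e).comp (u := fun x : ℝ =>
      ENNReal.ofReal (x ^ (-((1 - 1 / Real.log n) / s)))) (by fun_prop)).lintegral_eq
    have h2 : ∫⁻ ω, ENNReal.ofReal ((Z ω ^ s) ^ (-((1 - 1 / Real.log n) / s))) ∂P₀ =
        ∫⁻ ω, ENNReal.ofReal (Z ω ^ (-(1 - 1 / Real.log n))) ∂P₀ := by
      refine lintegral_congr_ae ?_
      filter_upwards [hZpos] with ω hω
      rw [← Real.rpow_mul hω.le]
      congr 2
      field_simp
    refine (h1.trans h2).trans_le
      ((lintegral_rpow_neg_le hZ hZpos hC.le hup ha0 ha1).trans_eq ?_)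
    congr 2
    field_simp
    ring
  -- paths of the wrong length are heavy
  have hy1 : y < 1 := by
    rw [hy, Real.exp_lt_one_iff]
    have : 0 < 1 / (48 * (s * (K : ℝ) ^ 2)) := by positivity
    linarith
  have hbad1 := measureReal_exists_light_path_le hY hYm hYpos (div_pos ha0 hs)
    (by positivity : 0 ≤ 1 + C * Real.log n) hYmom (by positivity : 0 < K * τ)
    (hy ▸ (Real.exp_pos _).le) hy1 (K := K)
    (fun k hk hne => hy ▸ expected_light_paths_le hn2 (by omega) hk hne hs hKs (by linarith) hC
      (by positivity) herr)
    (u := ⟨0, by omega⟩) (v := ⟨1, by omega⟩) (by simp)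
  -- a light path exists
  obtain ⟨m, hm0, hmn, hp0, hrq, hle⟩ := layered_error_le (c := c) hK hs hKs hKL hL hcL hn hn3
    (hlow _ (Real.exp_pos _).le hx₀)
  have hbad2 := (measureReal_no_open_path_le hY hYm hYp hp0 hK hm0 hmn hn2 hrq).trans hle
  have hae : ∀ᵐ ω ∂P, (∀ p q : (⊤ : SimpleGraph (Fin n)).Path ⟨0, by omega⟩ ⟨1, by omega⟩,
      p ≠ q → ∑ e ∈ pathEdges p, Y e ω ≠ ∑ e ∈ pathEdges q, Y e ω) ∧
      ∀ e : (⊤ : SimpleGraph (Fin n)).edgeSet, X e ω = Y e ω :=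
    (ae_forall_sum_pathEdges_ne hY hYm hYatom).and (ae_all_iff.2 hYX)
  set B₁ := {ω | ∃ q : (⊤ : SimpleGraph (Fin n)).Path ⟨0, by omega⟩ ⟨1, by omega⟩,
    (q : (⊤ : SimpleGraph (Fin n)).Walk ⟨0, by omega⟩ ⟨1, by omega⟩).length ≠ K ∧
      ∑ e ∈ pathEdges q, Y e ω ≤ K * τ} with hB₁
  set B₂ := {ω | ∀ q : (⊤ : SimpleGraph (Fin n)).Path ⟨0, by omega⟩ ⟨1, by omega⟩,
    K * τ < ∑ e ∈ pathEdges q, Y e ω} with hB₂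
  have hcover : ∀ᵐ ω ∂P, ω ∈ {ω | completeHopcount n (fun e => X e ω) = K} ∪ (B₁ ∪ B₂) := by
    filter_upwards [hae] with ω hω
    by_contra hcon
    simp only [Set.mem_union, not_or] at hcon
    obtain ⟨h1, h2, h3⟩ := hcon
    refine h1 ?_
    change completeHopcount n (fun e => X e ω) = K
    rw [completeHopcount, dif_pos hn2]
    have hw : ∀ q : (⊤ : SimpleGraph (Fin n)).Path ⟨0, by omega⟩ ⟨1, by omega⟩,
        pathWeight (fun e => X e ω) q = ∑ e ∈ pathEdges q, Y e ω := fun q => by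
      rw [pathWeight_eq_sum_pathEdges]
      exact Finset.sum_congr rfl fun e _ => hω.2 e
    refine hopcount_eq_of_forall _ K (K * τ) ?_ ?_ ?_
    · by_contra! h
      exact h3 fun q => hw q ▸ h q
    · intro q hq
      by_contra! h
      exact h2 ⟨q, hq, hw q ▸ h⟩
    · intro p q hpq
      rw [hw, hw]
      exact hω.1 p q hpq
  -- Only monotonicity and subadditivity are needed, so measurability of the hopcount event plays no
  -- role.
  have hone : 1 ≤ P.real ({ω | completeHopcount n (fun e => X e ω) = K} ∪ (B₁ ∪ B₂)) := by
    rw [← probReal_univ (μ := P), measureReal_def, measureReal_def]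
    exact ENNReal.toReal_mono (measure_ne_top _ _) (measure_mono_ae (hcover.mono fun ω h _ => h))
  have h1 := measureReal_union_le (μ := P) {ω | completeHopcount n (fun e => X e ω) = K} (B₁ ∪ B₂)
  have h2 := measureReal_union_le (μ := P) B₁ B₂
  linarith

end Hopcount

/-! ### Passage to the limit. -/

theorem tendsto_exp_neg_div_one_sub {z : ℕ → ℝ} (hz : Tendsto z atTop (𝓝[>] 0)) :
    Tendsto (fun n => Real.exp (-(1 / (48 * z n))) / (1 - Real.exp (-(1 / (48 * z n)))))
      atTop (𝓝 0) := by
  have h1 : Tendsto (fun n => 1 / (48 * z n)) atTop atTop := by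
    have := (tendsto_inv_nhdsGT_zero.comp hz).const_mul_atTop (show (0 : ℝ) < 1 / 48 by norm_num)
    refine this.congr fun n => ?_
    simp only [Function.comp_apply, one_div, mul_inv]
  have h2 : Tendsto (fun n => Real.exp (-(1 / (48 * z n)))) atTop (𝓝 0) :=
    Real.tendsto_exp_neg_atTop_nhds_zero.comp h1
  have := h2.div (h2.const_sub 1) (by norm_num)
  rwa [sub_zero, zero_div] at this

theorem corollary5p6
    -- the positive random variable `Z`, with continuous distribution function `G`
    {Ω₀ : Type*} [MeasurableSpace Ω₀] (P₀ : Measure Ω₀) [IsProbabilityMeasure P₀]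
    (Z : Ω₀ → ℝ) (hZ : AEMeasurable Z P₀) (hZpos : ∀ᵐ ω ∂P₀, 0 < Z ω)
    (G : ℝ → ℝ) (hG : ∀ x, G x = cdf (P₀.map Z) x) (hGcont : Continuous G)
    -- `G` is twice continuously differentiable on `[0, xhat]`, with positive right derivative at 0
    (xhat : ℝ) (hxhat : 0 < xhat) (hGC2 : ContDiffOn ℝ 2 G (Set.Icc 0 xhat))
    (lam : ℝ) (hlam : 0 < lam) (hGderiv : HasDerivWithinAt G lam (Set.Ici 0) 0)
    -- the sequence `s`
    (s : ℕ → ℝ) (hs : ∀ n, 0 < s n)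
    (hs_upper : Tendsto (fun n : ℕ => s n ^ 3 * Real.log n ^ 2 * Real.log (Real.log n))
      atTop (𝓝 0))
    (hs_lower : Tendsto (fun n : ℕ => s n * Real.log n) atTop atTop)
    -- for every `n`, i.i.d. weights distributed as `Z ^ s n` on the edges of the complete graph
    {Ω : ℕ → Type*} [∀ n, MeasurableSpace (Ω n)] (P : ∀ n, Measure (Ω n))
    [∀ n, IsProbabilityMeasure (P n)]
    (X : ∀ n, Sym2 (Fin n) → Ω n → ℝ)
    (hXindep : ∀ n, iIndepFun (fun e : (⊤ : SimpleGraph (Fin n)).edgeSet => X n e) (P n))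
    (hXlaw : ∀ n, ∀ e ∈ (⊤ : SimpleGraph (Fin n)).edgeSet,
      IdentDistrib (X n e) (fun ω => Z ω ^ s n) (P n) P₀)
    -- `k n = s n * log n` for all large `n`
    (k : ℕ → ℕ) (hk : ∀ᶠ n : ℕ in atTop, (k n : ℝ) = s n * Real.log n) :
    Tendsto (fun n => P n {ω | completeHopcount n (fun e => X n e ω) = k n}) atTop (𝓝 1) := by
  have hGP : ∀ x, G x = P₀.real {ω | Z ω ≤ x} := fun x => by
    rw [hG, cdf_map_eq_measureReal hZ]
  have hZatom : ∀ y, P₀ {ω | Z ω = y} = 0 :=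
    measure_eq_zero_of_continuous_cdf hZ (by
      have : (cdf (P₀.map Z) : ℝ → ℝ) = G := funext fun x => (hG x).symm
      rwa [this])
  have hG0 : G 0 = 0 := by
    rw [hGP, measureReal_eq_zero_iff]
    refine measure_mono_null (fun ω hω => ?_) (ae_iff.1 hZpos)
    exact not_lt.2 hω
  obtain ⟨c, C, x₀, hc, hC, hx₀, hup, hlow⟩ :=
    exists_linear_bounds hlam hG0 (fun x => hGP x ▸ measureReal_le_one) hGderiv
  simp only [hGP] at hup hlow
  have hLtop : Tendsto (fun n : ℕ => Real.log n) atTop atTop :=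
    Real.tendsto_log_atTop.comp tendsto_natCast_atTop_atTop
  have hLLtop : Tendsto (fun n : ℕ => Real.log (Real.log n)) atTop atTop :=
    Real.tendsto_log_atTop.comp hLtop
  have hlog_small : ∀ ε : ℝ, 0 < ε → ∀ᶠ x : ℝ in atTop, Real.log x ≤ ε * x := fun ε hε => by
    filter_upwards [Real.isLittleO_log_id_atTop.def hε, eventually_ge_atTop 0] with x hx hx0
    rw [id, Real.norm_eq_abs, Real.norm_eq_abs, abs_of_nonneg hx0] at hx
    exact (le_abs_self _).trans hx
  have hev : ∀ᶠ n : ℕ in atTop,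
      1 - (Real.exp (-(1 / (48 * (s n ^ 3 * Real.log n ^ 2)))) /
        (1 - Real.exp (-(1 / (48 * (s n ^ 3 * Real.log n ^ 2))))) + 15 / Real.log n) ≤
      (P n).real {ω | completeHopcount n (fun e => X n e ω) = k n} := by
    filter_upwards [hk, hs_lower.eventually_ge_atTop 2, hLtop.eventually_ge_atTop 10,
      hLtop.eventually_ge_atTop (2 / c), hLtop.eventually_ge_atTop (1 + C),
      hLtop.eventually_ge_atTop (-4 * Real.log x₀), hLLtop.eventually_ge_atTop 1,
      hs_upper.eventually_le_const (show (0 : ℝ) < 1 / 288 by norm_num),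
      hLtop.eventually (hlog_small (1 / 12) (by norm_num)),
      tendsto_natCast_atTop_atTop.eventually (hlog_small (1 / 4) (by norm_num)),
      tendsto_natCast_atTop_atTop.eventually_ge_atTop (8 : ℝ)]
      with n hkn hK2 hL10 hLc hLC hLx hLL hρ hlogL hlogn hn8
    have hsn := hs n
    set L := Real.log n with hLdef
    set LL := Real.log L with hLLdef
    have hL0 : 0 < L := by linarith
    have hn0 : (0 : ℝ) < n := by linarith
    have hK2' : 2 ≤ k n := by
      have : (2 : ℝ) ≤ k n := by rw [hkn]; exact hK2
      exact_mod_cast this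
    have hs1 : s n ≤ 1 := by
      by_contra! h
      have h1 : 1 ≤ s n ^ 3 := one_le_pow₀ h.le
      have h2 : (1 : ℝ) ≤ L ^ 2 := one_le_pow₀ (by linarith)
      have h3 : (1 : ℝ) ≤ s n ^ 3 * L ^ 2 * LL :=
        one_le_mul_of_one_le_of_one_le (one_le_mul_of_one_le_of_one_le h1 h2) hLL
      linarith
    have hKL : (k n : ℝ) ≤ L := by
      rw [hkn]
      exact mul_le_of_le_one_left hL0.le hs1
    have hK0 : (0 : ℝ) < k n := by rw [hkn]; positivity
    have hmain := le_measureReal_completeHopcount_eq (P := P n) (n := n) hZ hZpos hZatom hC hup hlow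
      hsn (hXindep n) (hXlaw n) hK2' hkn hKL hL10 ?_ (by linarith) ?_ ?_ ?_ rfl
    · rwa [hkn, show s n * (s n * L) ^ 2 = s n ^ 3 * L ^ 2 by ring] at hmain
    · rw [div_le_iff₀ hc] at hLc
      linarith
    · have h1 : L ^ 3 = Real.exp ((3 : ℕ) * LL) := by
        rw [Real.exp_nat_mul, hLLdef, Real.exp_log hL0]
      rw [h1, ← Real.exp_log hn0, ← hLdef]
      refine Real.exp_le_exp.2 ?_
      push_cast
      linarith
    -- From `s L ≥ 2` and `3 log L ≤ L / 4`, the exponent is at most `-L / 4`.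
    · rw [← Real.exp_log hx₀]
      refine Real.exp_le_exp.2 ?_
      rw [div_le_iff₀ hsn, hkn]
      nlinarith
    · have h1 : Real.log (1 + C * L) ≤ 2 * LL := by
        have h2 : 1 + C * L ≤ L ^ 2 := by nlinarith
        have h3 := Real.log_le_log (by positivity) h2
        rw [Real.log_pow] at h3
        exact_mod_cast h3
      -- Here `6 = 1 + 3 + 2` because `LL ≥ 1`; this explains the threshold `1/288 = 1/(6 · 48)`
      -- above.
      have h4 : s n + 3 * s n * LL + s n * Real.log (1 + C * L) ≤ 6 * s n * LL := by nlinarith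
      refine h4.trans ?_
      rw [le_div_iff₀ (by positivity), hkn]
      nlinarith
  have hz : Tendsto (fun n : ℕ => s n ^ 3 * Real.log n ^ 2) atTop (𝓝[>] 0) := by
    refine tendsto_nhdsWithin_iff.2 ⟨?_, ?_⟩
    · refine tendsto_of_tendsto_of_tendsto_of_le_of_le' tendsto_const_nhds hs_upper ?_ ?_
      · exact Eventually.of_forall fun n => mul_nonneg (pow_pos (hs n) 3).le (sq_nonneg _)
      · filter_upwards [hLLtop.eventually_ge_atTop 1] with n hn
        exact le_mul_of_one_le_right (mul_nonneg (pow_pos (hs n) 3).le (sq_nonneg _)) hn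
    · filter_upwards [hLtop.eventually_gt_atTop 0] with n hn
      exact mul_pos (pow_pos (hs n) 3) (pow_pos hn 2)
  have hlim : Tendsto (fun n : ℕ =>
      1 - (Real.exp (-(1 / (48 * (s n ^ 3 * Real.log n ^ 2)))) /
        (1 - Real.exp (-(1 / (48 * (s n ^ 3 * Real.log n ^ 2))))) + 15 / Real.log n))
      atTop (𝓝 1) := by
    have := ((tendsto_exp_neg_div_one_sub hz).add
      (hLtop.const_div_atTop 15)).const_sub 1
    simpa using this
  have hreal : Tendsto (fun n => (P n).real
      {ω | completeHopcount n (fun e => X n e ω) = k n}) atTop (𝓝 1) :=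
    tendsto_of_tendsto_of_tendsto_of_le_of_le' hlim tendsto_const_nhds hev
      (Eventually.of_forall fun n => measureReal_le_one)
  rw [← ENNReal.ofReal_one]
  exact (ENNReal.tendsto_ofReal hreal).congr fun n => ofReal_measureReal
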